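/- Let $d\ge 1$ and let $A=\begin{pmatrix}A_{LL}&A_{LR}\\A_{RL}&A_{RR}\end{pmatrix}$ be a Hermitian positive definite $2d\times 2d$ complex matrix with $d\times d$ blocks. For $z\in\mathbb C^*$ put $\Phi(z)=A_{LL}+A_{RR}+A_{LR}z+A_{RL}z^{-1}$, let $\mathcal S=\{w\in\mathbb C^*:\det\Phi(w)=0\}$, $\mathcal S_{<1}=\{w\in\mathcal S:|w|<1\}$, $\mathcal S_{>1}=\{w\in\mathcal S:|w|>1\}$, and for $k\in\mathbb Z$ let $C_k=\frac1{2\pi}\int_0^{2\pi}\Phi(e^{i\theta})^{-1}e^{-ik\theta}\,d\theta$. Assume that $A_{LR}$ is invertible and that every $w\in\mathcal S$ is a simple root of the polynomial $z^d\det\Phi(z)$ with $\dim\ker\Phi(w)=1$, and for each $w\in\mathcal S$ fix $u_w\ne0$ spanning $\ker\Phi(w)$. Then $(u_w)_{w\in\mathcal S_{<1}}$ and $(u_w)_{w\in\mathcal S_{>1}}$ are bases of $\mathbb C^d$. Let $W_{<1}$ (resp. $W_{>1}$) be the matrix with $W_{<1}u_w=wu_w$ for $w\in\mathcal S_{<1}$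 (resp. $W_{>1}u_w=wu_w$ for $w\in\mathcal S_{>1}$), and for $x\in\mathbb C^d$ write $x=\sum_{w\in\mathcal S_{<1}}x(w)u_w$, resp. $x=\sum_{w\in\mathcal S_{>1}}x(w)u_w$. The matrices $B_L=A_{RR}+A_{RL}W_{>1}^{-1}$ and $B_R=A_{LL}+A_{LR}W_{<1}$ are eigen-boundary conditions for $A$, that is, they are Hermitian positive definite and $$B_L=A_{RR}-A_{RL}(B_L+A_{LL})^{-1}A_{LR},\qquad B_R=A_{LL}-A_{LR}(A_{RR}+B_R)^{-1}A_{RL}.$$ Let $\alpha,\beta_L,\beta_R>0$ and let $X=(X_k)_{k\in\mathbb Z}$ be a $\mathbb C^d$-valued process distributed according to the infinite-volume Gibbs measure with these boundary conditions: for all $a\in\mathbb Z$ and $P\ge1$, the vector $(X_a,\dots,X_{a+P})$ has, with respect to Lebesgue measure on $\mathbb C^{d(P+1)}$, the density $$\frac1Z\;\beta_Le^{-\frac12x_0^*B_Lx_0}\;\prod_{k=0}^{P-1}\alpha\exp\Big(-\tfrac12\begin{pmatrix}x_k\\x_{k+1}\end{pmatrix}^{*}A\begin{pmatrix}x_k\\x_{k+1}\end{pmatrix}\Big)\;\beta_Re^{-\frac12x_P^*B_Rx_P},$$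 where $Z$ is the normalizing constant. Then every $X_l$ is square integrable and, for all $l\in\mathbb Z$ and $k\in\mathbb N$, almost surely, $$\mathbb E[X_{l-k}\mid X_l]=C_kC_0^{-1}X_l=W_{>1}^{-k}X_l=\sum_{w\in\mathcal S_{>1}}w^{-k}X_l(w)u_w,$$ $$\mathbb E[X_{l+k}\mid X_l]=C_{-k}C_0^{-1}X_l=W_{<1}^{k}X_l=\sum_{w\in\mathcal S_{<1}}w^{k}X_l(w)u_w.$$ Moreover, for all $k_1\le k_2$ in $\mathbb N$, almost surely, $$\mathrm{Cov}(X_{l+k_1},X_{l+k_2}\mid X_l)\,C_0^{-1}=W_{>1}^{k_1-k_2}-W_{<1}^{k_1}W_{>1}^{-k_2}.$$ Here $\mathrm{Cov}(U,V\mid Y)=\tfrac12\,\mathbb E\big[(U-\mathbb E[U\mid Y])(V-\mathbb E[V\mid Y])^*\mid Y\big]$ is the covariance of complex vectors normalized so that the centered circularly symmetric Gaussian vector on $\mathbb C^n$ with density proportional to $e^{-\frac12x^*Qx}$ has covariance matrix $Q^{-1}$. -/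

import Mathlib

open MeasureTheory
open scoped ComplexOrder

noncomputable section

namespace GaussMarkov

variable {d : ℕ}

/-- Square matrices of size `2d`, with rows and columns split into a left (`Sum.inl`) and a right
(`Sum.inr`) block of size `d`: `A = (A_LL, A_LR; A_RL, A_RR)`. -/
abbrev BlockMatrix (d : ℕ) : Type := Matrix (Fin d ⊕ Fin d) (Fin d ⊕ Fin d) ℂ

/-- The block `A_LL`. -/
abbrev blkLL (A : BlockMatrix d) : Matrix (Fin d) (Fin d) ℂ := A.toBlocks₁₁
/-- The block `A_LR`. -/
abbrev blkLR (A : BlockMatrix d) : Matrix (Fin d) (Fin d) ℂ := A.toBlocks₁₂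
/-- The block `A_RL`. -/
abbrev blkRL (A : BlockMatrix d) : Matrix (Fin d) (Fin d) ℂ := A.toBlocks₂₁
/-- The block `A_RR`. -/
abbrev blkRR (A : BlockMatrix d) : Matrix (Fin d) (Fin d) ℂ := A.toBlocks₂₂

/-- `Φ_A(z) = A_LL + A_RR + A_LR z + A_RL z⁻¹`, used for `z ≠ 0` only. -/
def Phi (A : BlockMatrix d) (z : ℂ) : Matrix (Fin d) (Fin d) ℂ :=
  blkLL A + blkRR A + z • blkLR A + z⁻¹ • blkRL A

/-- The polynomial `z ^ d * det Φ_A(z) = det (A_LR z ^ 2 + (A_LL + A_RR) z + A_RL)`. -/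
def zeroPoly (A : BlockMatrix d) : Polynomial ℂ :=
  Matrix.det ((Polynomial.X : Polynomial ℂ) ^ 2 • (blkLR A).map Polynomial.C + (Polynomial.X : Polynomial ℂ) • (blkLL A + blkRR A).map Polynomial.C
    + (blkRL A).map Polynomial.C)

theorem zeroPoly_eval (A : BlockMatrix d) {z : ℂ} (hz : z ≠ 0) :
    (zeroPoly A).eval z = z ^ d * (Phi A z).det := by
  have h1 : z ^ d * (Phi A z).det = (z • Phi A z).det := by
    rw [Matrix.det_smul, Fintype.card_fin]
  rw [h1, zeroPoly, ← Polynomial.coe_evalRingHom, RingHom.map_det]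
  congr 1
  ext i j
  simp [Phi]
  field_simp
  ring

/-- The zeros of `Φ_A` in `ℂ \ {0}`. -/
def zeros (A : BlockMatrix d) : Set ℂ := {z | z ≠ 0 ∧ (Phi A z).det = 0}

/-- The zeros of `Φ_A` inside the unit disk. -/
def zerosIn (A : BlockMatrix d) : Set ℂ := {w | w ∈ zeros A ∧ ‖w‖ < 1}

/-- The zeros of `Φ_A` outside the unit disk. -/
def zerosOut (A : BlockMatrix d) : Set ℂ := {w | w ∈ zeros A ∧ 1 < ‖w‖}

/-- The full rank assumption. -/
def FullRank (A : BlockMatrix d) : Prop := (blkLR A).rank = d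

/-- Every zero `w` of `Φ_A` is a simple root of `z ^ d * det Φ_A(z)`, and the kernel of `Φ_A(w)`
is a line. -/
def SimpleZeros (A : BlockMatrix d) : Prop :=
  ∀ w ∈ zeros A, (zeroPoly A).rootMultiplicity w = 1 ∧
    Module.finrank ℂ (LinearMap.ker (Phi A w).mulVecLin) = 1

/-- `u w` is a non-zero vector that spans the kernel of `Φ_A(w)`, for each zero `w`. -/
def SpansKernels (A : BlockMatrix d) (u : ℂ → Fin d → ℂ) : Prop :=
  ∀ w ∈ zeros A, u w ≠ 0 ∧ LinearMap.ker (Phi A w).mulVecLin = Submodule.span ℂ {u w}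

/-- The matrix which is diagonal in a basis `(b w)` indexed by a set of complex numbers, the vector
`b w` being an eigenvector for the eigenvalue `w`. -/
def diagIn {S : Set ℂ} (b : Module.Basis S ℂ (Fin d → ℂ)) : Matrix (Fin d) (Fin d) ℂ :=
  LinearMap.toMatrix' (b.constr ℂ fun w : S => (w : ℂ) • b w)

theorem diagIn_mulVec {S : Set ℂ} (b : Module.Basis S ℂ (Fin d → ℂ)) (w : S) :
    Matrix.mulVec (diagIn b) (b w) = (w : ℂ) • b w := by
  rw [diagIn, LinearMap.toMatrix'_mulVec, Module.Basis.constr_basis]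

/-- The `k`-th Fourier coefficient `C_k` of `θ ↦ Φ_A(e^{iθ})⁻¹`. -/
def fourierC (A : BlockMatrix d) (k : ℤ) : Matrix (Fin d) (Fin d) ℂ :=
  Matrix.of fun i j => (1 / (2 * Real.pi) : ℂ) * ∫ θ in (0 : ℝ)..(2 * Real.pi),
    (Phi A (Complex.exp (Complex.I * θ)))⁻¹ i j * Complex.exp (-(Complex.I * k * θ))

/-- `B` is a left Schur-invariant (Hermitian positive definite) matrix for `A`. -/
def IsLeftSchurInvariant (A : BlockMatrix d) (B : Matrix (Fin d) (Fin d) ℂ) : Prop :=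
  B.PosDef ∧ B = blkRR A - blkRL A * (B + blkLL A)⁻¹ * blkLR A

/-- `B` is a right Schur-invariant (Hermitian positive definite) matrix for `A`. -/
def IsRightSchurInvariant (A : BlockMatrix d) (B : Matrix (Fin d) (Fin d) ℂ) : Prop :=
  B.PosDef ∧ B = blkLL A - blkLR A * (blkRR A + B)⁻¹ * blkRL A

/-- The left eigen-boundary matrix `B_L = A_RR + A_RL W_{>1}⁻¹`. -/
def leftBoundary (A : BlockMatrix d) (Wout : Matrix (Fin d) (Fin d) ℂ) :
    Matrix (Fin d) (Fin d) ℂ :=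
  blkRR A + blkRL A * Wout⁻¹

/-- The right eigen-boundary matrix `B_R = A_LL + A_LR W_{<1}`. -/
def rightBoundary (A : BlockMatrix d) (Win : Matrix (Fin d) (Fin d) ℂ) :
    Matrix (Fin d) (Fin d) ℂ :=
  blkLL A + blkLR A * Win

/-- The Gaussian weight `α exp(-½ (x, y)^* A (x, y))`. For Hermitian `A` the quadratic form is
real, so that taking its real part changes nothing. -/
def edgeWeight (α : ℝ) (A : BlockMatrix d) (x y : Fin d → ℂ) : ℝ :=
  α * Real.exp (-(1 / 2) *
    (dotProduct (star (Sum.elim x y)) (Matrix.mulVec A (Sum.elim x y))).re)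

/-- The Gaussian boundary weight `β exp(-½ x^* B x)`, with the same remark. -/
def boundaryWeight (β : ℝ) (B : Matrix (Fin d) (Fin d) ℂ) (x : Fin d → ℂ) : ℝ :=
  β * Real.exp (-(1 / 2) * (dotProduct (star x) (Matrix.mulVec B x)).re)

/-- The unnormalized density of the homogeneous Gaussian Markov process of size `P`. -/
def chainWeight (α : ℝ) (A : BlockMatrix d) (βL : ℝ) (BL : Matrix (Fin d) (Fin d) ℂ)
    (βR : ℝ) (BR : Matrix (Fin d) (Fin d) ℂ) (P : ℕ) (x : Fin (P + 1) → Fin d → ℂ) : ℝ :=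
  boundaryWeight βL BL (x 0) * (∏ k : Fin P, edgeWeight α A (x k.castSucc) (x k.succ)) *
    boundaryWeight βR BR (x (Fin.last P))

/-- The partition function. -/
def partitionFunction (α : ℝ) (A : BlockMatrix d) (βL : ℝ) (BL : Matrix (Fin d) (Fin d) ℂ)
    (βR : ℝ) (BR : Matrix (Fin d) (Fin d) ℂ) (P : ℕ) : ℝ :=
  ∫ x : Fin (P + 1) → Fin d → ℂ, chainWeight α A βL BL βR BR P x

/-- The law of the homogeneous Gaussian Markov process of size `P`, given by its density with
respect to Lebesgue measure on `(ℂ^d)^(P+1)`. -/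
def chainLaw (α : ℝ) (A : BlockMatrix d) (βL : ℝ) (BL : Matrix (Fin d) (Fin d) ℂ)
    (βR : ℝ) (BR : Matrix (Fin d) (Fin d) ℂ) (P : ℕ) : Measure (Fin (P + 1) → Fin d → ℂ) :=
  volume.withDensity fun x => ENNReal.ofReal
    ((partitionFunction α A βL BL βR BR P)⁻¹ * chainWeight α A βL BL βR BR P x)

/-- The process `(X_k)_{k ∈ ℤ}` has as its law under `μ` the infinite volume Gibbs measure with
weight `(α, A)` and boundary conditions `(βL, BL)`, `(βR, BR)`: on every finite window
`a, a + 1, …, a + P` it is the homogeneous Gaussian Markov process of size `P`. -/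
structure IsGibbsProcess {Ω : Type*} [MeasurableSpace Ω] (μ : Measure Ω)
    (α : ℝ) (A : BlockMatrix d) (βL : ℝ) (BL : Matrix (Fin d) (Fin d) ℂ)
    (βR : ℝ) (BR : Matrix (Fin d) (Fin d) ℂ) (X : ℤ → Ω → Fin d → ℂ) : Prop where
  measurable : ∀ k, Measurable (X k)
  law : ∀ (a : ℤ) (P : ℕ), 0 < P →
    μ.map (fun ω (k : Fin (P + 1)) => X (a + (k : ℕ)) ω) = chainLaw α A βL BL βR BR P

/-- The σ-algebra generated by a `ℂ^d`-valued random variable. -/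
abbrev sigmaOf {Ω : Type*} (Z : Ω → Fin d → ℂ) : MeasurableSpace Ω :=
  MeasurableSpace.comap Z inferInstance

/-- Conditional covariance matrix of `ℂ^d`-valued random variables,
`½ E[(U - E[U|m]) (V - E[V|m])^* | m]`. The factor `½` is the normalization of covariances of
complex vectors for which the circularly symmetric Gaussian vector with density proportional to
`exp(-½ x^* Q x)` on `ℂ^n`, i.e. with characteristic function
`E[exp(i Re ⟨a, X⟩)] = exp(-½ a^* Q⁻¹ a)`, has covariance matrix `Q⁻¹`. -/
def condCov {Ω : Type*} (m : MeasurableSpace Ω) [MeasurableSpace Ω] (μ : Measure Ω)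
    (U V : Ω → Fin d → ℂ) (ω : Ω) : Matrix (Fin d) (Fin d) ℂ :=
  Matrix.of fun i j =>
    (μ[fun ω' => (1 / 2 : ℂ) * ((U ω' i - (μ[U|m]) ω' i) * star (V ω' j - (μ[V|m]) ω' j))|m]) ω

end GaussMarkov

end

/-! ### Energy of harmonic sequences, independence of kernel vectors, positivity of boundary
matrices. -/

noncomputable section

open Filter Topology Matrix

namespace GaussMarkov

variable {d : ℕ}

/-! Write `W` for $W_{<1}$ and `V` for $W_{>1}^{-1}$. Both have spectrum in the open unit disk and
solve a quadratic matrix equation: `W` that of `A`, `V` that of `swapBlocks A` (`IsStableSolvent`).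
Everything except the construction of the two bases uses only these facts, and every backward
statement is the forward one for `swapBlocks A`.

Along a solution of the three-term recursion the energies of consecutive pairs telescope
(`sum_energy`), so for a decaying solution the first energy is at most the initial flux
(`energy_le_leftFlux`). This one inequality gives two things. A decaying solution with $x_0=0$ has
$x_1=0$, hence kernel vectors inside the disk are independent; with $2d$ simple zeros, none on the
circle, each half has exactly $d$ elements (`exists_bases`). And $x^*B_Rx$ dominates a positive
energy, so $B_R$ is positive definite (`IsStableSolvent.posDef`).

Let $K=A_{RR}+B_R$ and $G=B_L+B_R$. The quadratic equation says $KW=-A_{RL}$, from which follow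
Schur invariance, the intertwining $GV=W^*G$, and $K^{-1}=G^{-1}-WG^{-1}W^*$. Two geometric series
in `V` and `W` invert $\Phi$ on the circle, so $C_k=V^kG^{-1}$ and $C_{-k}=W^kG^{-1}$ for $k\ge0$.

On the probabilistic side, completing the square (`energy_add_boundary`) splits one factor off the
density: $X_{k+1}-WX_k$ is Gaussian with precision $K$ and independent of the past window. The
process is thus autoregressive; predictions are powers of `W`, and conditional covariances are sums
$\sum_i W^iK^{-1}W^{*i}$, which telescope by the identity for $K^{-1}$. -/

/-- The block matrix with the roles of left and right exchanged. -/
def swapBlocks (A : BlockMatrix d) : BlockMatrix d := A.submatrix Sum.swap Sum.swap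

theorem posDef_swapBlocks {A : BlockMatrix d} (hA : A.PosDef) : (swapBlocks A).PosDef :=
  hA.submatrix Sum.swap_leftInverse.injective

theorem blkRL_eq_conjTranspose {A : BlockMatrix d} (hA : A.IsHermitian) :
    blkRL A = (blkLR A)ᴴ := by
  ext i j
  exact (hA.apply (Sum.inr i) (Sum.inl j)).symm

/-- The quadratic form of `A` at the pair `(x, y)`. -/
def energy (A : BlockMatrix d) (x y : Fin d → ℂ) : ℂ :=
  star (Sum.elim x y) ⬝ᵥ (A *ᵥ Sum.elim x y)

theorem energy_eq (A : BlockMatrix d) (x y : Fin d → ℂ) :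
    energy A x y = star x ⬝ᵥ (blkLL A *ᵥ x + blkLR A *ᵥ y)
      + star y ⬝ᵥ (blkRL A *ᵥ x + blkRR A *ᵥ y) := by
  have h : A *ᵥ Sum.elim x y
      = Sum.elim (blkLL A *ᵥ x + blkLR A *ᵥ y) (blkRL A *ᵥ x + blkRR A *ᵥ y) := by
    conv_lhs => rw [← Matrix.fromBlocks_toBlocks A]
    exact Matrix.fromBlocks_mulVec _ _ _ _ _
  have hs : star (Sum.elim x y) = Sum.elim (star x) (star y) := by
    ext i; rcases i with i | i <;> rfl
  rw [energy, h, hs, sumElim_dotProduct_sumElim]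

theorem energy_pos {A : BlockMatrix d} (hA : A.PosDef) {x y : Fin d → ℂ}
    (h : x ≠ 0 ∨ y ≠ 0) : 0 < energy A x y := by
  refine hA.dotProduct_mulVec_pos fun h0 => ?_
  rcases h with h | h
  · exact h (funext fun i => congrFun h0 (Sum.inl i))
  · exact h (funext fun i => congrFun h0 (Sum.inr i))

theorem energy_nonneg {A : BlockMatrix d} (hA : A.PosDef) (x y : Fin d → ℂ) :
    0 ≤ energy A x y :=
  hA.posSemidef.dotProduct_mulVec_nonneg _

/-- The sequence `x` solves the three term recursion attached to `A`. -/
def IsHarmonic (A : BlockMatrix d) (x : ℕ → Fin d → ℂ) : Prop :=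
  ∀ k, blkRL A *ᵥ x k + (blkLL A + blkRR A) *ᵥ x (k + 1) + blkLR A *ᵥ x (k + 2) = 0

/-- The flux of the energy through the left end of a pair of sites. -/
def leftFlux (A : BlockMatrix d) (x y : Fin d → ℂ) : ℂ :=
  star x ⬝ᵥ (blkLL A *ᵥ x + blkLR A *ᵥ y)

/-- The energy of a pair is the flux at its left end plus a term at its right end; the recursion
identifies the latter with minus the left flux of the next pair. -/
theorem sum_energy {A : BlockMatrix d} {x : ℕ → Fin d → ℂ} (hx : IsHarmonic A x) (N : ℕ) :
    ∑ k ∈ Finset.range N, energy A (x k) (x (k + 1))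
      = leftFlux A (x 0) (x 1) - leftFlux A (x N) (x (N + 1)) := by
  induction N with
  | zero => simp
  | succ N ih =>
    rw [Finset.sum_range_succ, ih, energy_eq]
    have h := congrArg (fun v => star (x (N + 1)) ⬝ᵥ v) (hx N)
    simp only [leftFlux, dotProduct_add, Matrix.add_mulVec, dotProduct_zero] at h ⊢
    linear_combination h

/-- The final flux tends to zero, so the total energy is the initial flux; all terms are nonnegative
and only the first is kept. -/
theorem energy_le_leftFlux {A : BlockMatrix d} (hA : A.PosDef) {x : ℕ → Fin d → ℂ}
    (hx : IsHarmonic A x) (h0 : Tendsto x atTop (𝓝 0)) :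
    energy A (x 0) (x 1) ≤ leftFlux A (x 0) (x 1) := by
  have hc : Continuous fun p : (Fin d → ℂ) × (Fin d → ℂ) => leftFlux A p.1 p.2 := by
    unfold leftFlux; fun_prop
  have h1 : Tendsto (fun N => leftFlux A (x N) (x (N + 1))) atTop (𝓝 0) := by
    have := (hc.tendsto (0, 0)).comp (h0.prodMk_nhds (h0.comp (tendsto_add_atTop_nat 1)))
    simpa [leftFlux, Function.comp_def] using this
  have h2 : Tendsto (fun N => ∑ k ∈ Finset.range N, energy A (x k) (x (k + 1))) atTop
      (𝓝 (leftFlux A (x 0) (x 1))) := by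
    simp only [sum_energy hx]
    simpa using h1.const_sub (leftFlux A (x 0) (x 1))
  refine ge_of_tendsto h2 (eventually_atTop.2 ⟨1, fun N hN => ?_⟩)
  refine (Finset.single_le_sum (f := fun k => energy A (x k) (x (k + 1)))
    (fun k _ => energy_nonneg hA _ _) (Finset.mem_range.2 hN))

/-- `v` is an eigenvector of the quadratic pencil of `A` for the eigenvalue `w`. -/
def IsPencilVec (A : BlockMatrix d) (w : ℂ) (v : Fin d → ℂ) : Prop :=
  blkRL A *ᵥ v + w • ((blkLL A + blkRR A) *ᵥ v) + w ^ 2 • (blkLR A *ᵥ v) = 0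

theorem isHarmonic_sum {A : BlockMatrix d} {ι : Type*} [Fintype ι] {w : ι → ℂ}
    {v : ι → Fin d → ℂ} (h : ∀ i, IsPencilVec A (w i) (v i)) (c : ι → ℂ) :
    IsHarmonic A fun k => ∑ i, (c i * w i ^ k) • v i := by
  intro k
  simp only [Matrix.mulVec_sum, Matrix.mulVec_smul, ← Finset.sum_add_distrib]
  refine Finset.sum_eq_zero fun i _ => ?_
  have := congrArg (fun x => (c i * w i ^ k) • x) (h i)
  simp only [smul_add, smul_smul, smul_zero] at this
  rw [← this]
  congr 2
  · rw [mul_assoc, ← pow_succ]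
  · rw [mul_assoc, ← pow_add]

theorem tendsto_sum_pow {ι : Type*} [Fintype ι] {w : ι → ℂ} (hw : ∀ i, ‖w i‖ < 1)
    (v : ι → Fin d → ℂ) (c : ι → ℂ) :
    Tendsto (fun k : ℕ => ∑ i, (c i * w i ^ k) • v i) atTop (𝓝 0) := by
  have : Tendsto (fun k : ℕ => ∑ i, (c i * w i ^ k) • v i) atTop
      (𝓝 (∑ i, (c i * 0) • v i)) :=
    tendsto_finsetSum _ fun i _ =>
      ((tendsto_pow_atTop_nhds_zero_of_norm_lt_one (hw i)).const_mul (c i)).smul_const (v i)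
  simpa using this

/-- A relation among the $v_i$ is a decaying harmonic sequence starting at $0$. Its initial flux
vanishes, which forces its next value to vanish, and so on: the whole sequence is zero. -/
theorem linearIndependent_of_isPencilVec {A : BlockMatrix d} (hA : A.PosDef) {ι : Type*}
    [Fintype ι] {w : ι → ℂ} (hinj : Function.Injective w) (hw : ∀ i, ‖w i‖ < 1)
    {v : ι → Fin d → ℂ} (hv : ∀ i, v i ≠ 0) (h : ∀ i, IsPencilVec A (w i) (v i)) :
    LinearIndependent ℂ v := by
  have step : ∀ c : ι → ℂ, ∑ i, c i • v i = 0 → ∑ i, (c i * w i) • v i = 0 := by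
    intro c hc
    have h1 := energy_le_leftFlux hA (isHarmonic_sum h c) (tendsto_sum_pow hw v c)
    simp only [pow_zero, mul_one, pow_one, hc] at h1
    by_contra hne
    have h2 := energy_pos hA (x := 0) (Or.inr hne)
    have h3 := h2.trans_le h1
    simp [leftFlux] at h3
  rw [Fintype.linearIndependent_iff]
  intro c hc
  have all : ∀ k : ℕ, ∑ i, (c i * w i ^ k) • v i = 0 := by
    intro k
    induction k with
    | zero => simpa using hc
    | succ k ih =>
      have := step _ ih
      simpa only [pow_succ, mul_assoc] using this
  -- The sequences $k\mapsto w_i^kv_i$ are eigenvectors of the shift for distinct eigenvalues, so a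
  -- vanishing combination of them has zero coefficients.
  let f : Module.End ℂ (ℕ → Fin d → ℂ) := LinearMap.funLeft ℂ (Fin d → ℂ) Nat.succ
  have hli : LinearIndependent ℂ fun i : ι => (fun k : ℕ => w i ^ k • v i) := by
    refine Module.End.eigenvectors_linearIndependent' f w hinj _ fun i => ?_
    refine Module.End.hasEigenvector_iff.2 ⟨Module.End.mem_eigenspace_iff.2 ?_, fun h0 => ?_⟩
    · ext k j
      simp [f, LinearMap.funLeft_apply, pow_succ]
      ring
    · exact hv i (by simpa using congrFun h0 0)
  refine Fintype.linearIndependent_iff.1 hli c ?_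
  ext1 k
  rw [Finset.sum_apply]
  simpa [smul_smul] using all k

/-- `W` solves the quadratic matrix equation attached to `A`, and its powers tend to zero. -/
structure IsStableSolvent (A : BlockMatrix d) (W : Matrix (Fin d) (Fin d) ℂ) : Prop where
  eq : blkRL A + (blkLL A + blkRR A) * W + blkLR A * (W * W) = 0
  tendsto : Tendsto (fun k : ℕ => W ^ k) atTop (𝓝 0)

theorem pow_mulVec_eigenvector {B : Matrix (Fin d) (Fin d) ℂ} {c : ℂ} {v : Fin d → ℂ}
    (h : B *ᵥ v = c • v) (k : ℕ) : B ^ k *ᵥ v = c ^ k • v := by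
  induction k with
  | zero => simp
  | succ k ih => rw [pow_succ, ← Matrix.mulVec_mulVec, h, Matrix.mulVec_smul, ih, smul_smul,
      pow_succ']

theorem isStableSolvent_of_basis {A : BlockMatrix d} {ι : Type*} [Fintype ι] {w : ι → ℂ}
    (hw : ∀ i, ‖w i‖ < 1) (b : Module.Basis ι ℂ (Fin d → ℂ))
    (h : ∀ i, IsPencilVec A (w i) (b i)) {W : Matrix (Fin d) (Fin d) ℂ}
    (hW : ∀ i, W *ᵥ b i = w i • b i) : IsStableSolvent A W := by
  constructor
  · apply Matrix.toLin'.injective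
    refine b.ext fun i => ?_
    have := h i
    simp only [IsPencilVec, Matrix.add_mulVec] at this
    simp only [Matrix.toLin'_apply, Matrix.add_mulVec, ← Matrix.mulVec_mulVec, hW,
      Matrix.mulVec_smul, map_zero, LinearMap.zero_apply, smul_smul]
    rw [← this, smul_add, sq]
  · refine tendsto_pi_nhds.2 fun i => tendsto_pi_nhds.2 fun j => ?_
    have key : ∀ k : ℕ, W ^ k *ᵥ (Pi.single j 1)
        = ∑ l, (b.repr (Pi.single j 1) l * w l ^ k) • b l := by
      intro k
      conv_lhs => rw [← b.sum_repr (Pi.single j 1)]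
      simp only [Matrix.mulVec_sum, Matrix.mulVec_smul, pow_mulVec_eigenvector (hW _), smul_smul]
    have h2 := tendsto_pi_nhds.1 (tendsto_sum_pow hw b (b.repr (Pi.single j 1))) i
    refine h2.congr fun k => ?_
    rw [← key]
    simp

variable {A : BlockMatrix d} {W : Matrix (Fin d) (Fin d) ℂ}

theorem IsStableSolvent.isHarmonic (hW : IsStableSolvent A W) (x : Fin d → ℂ) :
    IsHarmonic A fun k => W ^ k *ᵥ x := by
  intro k
  have := congrArg (fun B => B *ᵥ (W ^ k *ᵥ x)) hW.eq
  simpa only [zero_mul, Matrix.add_mulVec, Matrix.mulVec_mulVec, Matrix.zero_mulVec,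
    Matrix.mul_assoc, pow_succ', add_mul] using this

theorem IsStableSolvent.tendsto_mulVec (hW : IsStableSolvent A W) (x : Fin d → ℂ) :
    Tendsto (fun k : ℕ => W ^ k *ᵥ x) atTop (𝓝 0) := by
  have hc : Continuous fun B : Matrix (Fin d) (Fin d) ℂ => B *ᵥ x := by fun_prop
  simpa [Function.comp_def] using (hc.tendsto 0).comp hW.tendsto

theorem isHermitian_of_forall_real {B : Matrix (Fin d) (Fin d) ℂ}
    (h : ∀ x : Fin d → ℂ, star (star x ⬝ᵥ (B *ᵥ x)) = star x ⬝ᵥ (B *ᵥ x)) : B.IsHermitian := by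
  rw [← Matrix.isSymmetric_toEuclideanLin_iff, LinearMap.isSymmetric_iff_inner_map_self_real]
  intro v
  have h1 := h v.ofLp
  have h2 : v.ofLp ⬝ᵥ star (B *ᵥ v.ofLp) = star (star v.ofLp ⬝ᵥ (B *ᵥ v.ofLp)) := by
    rw [← Matrix.star_dotProduct, dotProduct_comm]
  simp only [EuclideanSpace.inner_eq_star_dotProduct, Matrix.ofLp_toLpLin, Matrix.toLin'_apply,
    h2, h1]
  exact h1

/-- $x^*B_Rx$ is the initial flux of the decaying orbit $W^kx$, so it dominates the energy of the
first pair. In the order of $\mathbb C$ this inequality also makes the form real, which is what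
makes $B_R$ Hermitian. -/
theorem IsStableSolvent.posDef (hA : A.PosDef) (hW : IsStableSolvent A W) :
    (rightBoundary A W).PosDef := by
  have key : ∀ x : Fin d → ℂ, energy A x (W *ᵥ x) ≤ star x ⬝ᵥ (rightBoundary A W *ᵥ x) := by
    intro x
    have := energy_le_leftFlux hA (hW.isHarmonic x) (hW.tendsto_mulVec x)
    simpa [leftFlux, rightBoundary, Matrix.add_mulVec, Matrix.mulVec_mulVec] using this
  refine Matrix.PosDef.of_dotProduct_mulVec_pos (isHermitian_of_forall_real fun x => ?_)
    fun x hx => (energy_pos hA (Or.inl hx)).trans_le (key x)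
  exact (LE.le.isSelfAdjoint ((energy_nonneg hA _ _).trans (key x))).star_eq

end GaussMarkov
end

/-! ### Matrix identities for the precisions, counting of the zeros, eigenbases. -/

noncomputable section

open Filter Topology Matrix

namespace GaussMarkov

variable {d : ℕ} {A : BlockMatrix d} {V W : Matrix (Fin d) (Fin d) ℂ}

/-- The precision matrix of the innovations `X_{k+1} - W X_k`. -/
def innovationPrecision (A : BlockMatrix d) (W : Matrix (Fin d) (Fin d) ℂ) :
    Matrix (Fin d) (Fin d) ℂ :=
  blkRR A + rightBoundary A W

/-- The precision matrix of a single site. -/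
def sitePrecision (A : BlockMatrix d) (V W : Matrix (Fin d) (Fin d) ℂ) :
    Matrix (Fin d) (Fin d) ℂ :=
  rightBoundary (swapBlocks A) V + rightBoundary A W

theorem posDef_blkRR (hA : A.PosDef) : (blkRR A).PosDef :=
  hA.submatrix (e := Sum.inr) Sum.inr_injective

theorem posDef_innovationPrecision (hA : A.PosDef) (hW : IsStableSolvent A W) :
    (innovationPrecision A W).PosDef :=
  (posDef_blkRR hA).add (hW.posDef hA)

theorem posDef_sitePrecision (hA : A.PosDef) (hV : IsStableSolvent (swapBlocks A) V)
    (hW : IsStableSolvent A W) : (sitePrecision A V W).PosDef :=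
  (hV.posDef (posDef_swapBlocks hA)).add (hW.posDef hA)

theorem innovationPrecision_mul (hW : IsStableSolvent A W) :
    innovationPrecision A W * W = -blkRL A := by
  have := hW.eq
  rw [innovationPrecision, rightBoundary, eq_neg_iff_add_eq_zero, ← this]
  noncomm_ring

/-- Adjoint of `innovationPrecision_mul`; it relies on $K$ being Hermitian, hence on the positivity
of $B_R$. -/
theorem conjTranspose_mul_innovationPrecision (hA : A.PosDef) (hW : IsStableSolvent A W) :
    Wᴴ * innovationPrecision A W = -blkLR A := by
  have h := congrArg conjTranspose (innovationPrecision_mul hW)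
  rwa [conjTranspose_mul, (posDef_innovationPrecision hA hW).isHermitian.eq, conjTranspose_neg,
    blkRL_eq_conjTranspose hA.isHermitian, conjTranspose_conjTranspose] at h

theorem blkLR_mul_eq (hA : A.PosDef) (hW : IsStableSolvent A W) :
    blkLR A * W = Wᴴ * blkRL A := by
  rw [← neg_neg (blkRL A), ← innovationPrecision_mul hW, mul_neg, ← mul_assoc,
    conjTranspose_mul_innovationPrecision hA hW, neg_mul, neg_neg]

theorem isUnit_det_of_posDef {B : Matrix (Fin d) (Fin d) ℂ} (hB : B.PosDef) : IsUnit B.det :=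
  (Matrix.isUnit_iff_isUnit_det _).1 hB.isUnit

theorem eq_neg_inv_mul (hA : A.PosDef) (hW : IsStableSolvent A W) :
    (innovationPrecision A W)⁻¹ * blkRL A = -W := by
  rw [← neg_neg (blkRL A), ← innovationPrecision_mul hW, mul_neg,
    Matrix.nonsing_inv_mul_cancel_left _ _
      (isUnit_det_of_posDef (posDef_innovationPrecision hA hW))]

/-- Schur invariance is the quadratic equation with $K^{-1}A_{RL}=-W$ substituted. -/
theorem isRightSchurInvariant_rightBoundary (hA : A.PosDef) (hW : IsStableSolvent A W) :
    IsRightSchurInvariant A (rightBoundary A W) := by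
  refine ⟨hW.posDef hA, ?_⟩
  have h := eq_neg_inv_mul hA hW
  rw [innovationPrecision] at h
  rw [mul_assoc, h, mul_neg, sub_neg_eq_add, rightBoundary]

theorem isLeftSchurInvariant_of_swapBlocks {B : Matrix (Fin d) (Fin d) ℂ}
    (h : IsRightSchurInvariant (swapBlocks A) B) : IsLeftSchurInvariant A B := by
  refine ⟨h.1, ?_⟩
  rw [add_comm B]
  exact h.2

theorem sitePrecision_eq_innovation (A : BlockMatrix d) (V W : Matrix (Fin d) (Fin d) ℂ) :
    sitePrecision A V W = innovationPrecision A W + blkRL A * V := by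
  have : rightBoundary (swapBlocks A) V = blkRR A + blkRL A * V := rfl
  rw [sitePrecision, innovationPrecision, this]
  abel

theorem sitePrecision_eq_swap (A : BlockMatrix d) (V W : Matrix (Fin d) (Fin d) ℂ) :
    sitePrecision A V W = innovationPrecision (swapBlocks A) V + blkLR A * W := by
  have : blkRR (swapBlocks A) = blkLL A := rfl
  rw [sitePrecision, innovationPrecision, this, rightBoundary.eq_1 A]
  abel

/-- Time reversal at the level of matrices. Expanding $G$ around the backward precision on the left
and around the forward one on the right, both sides become $-A_{LR}+A_{LR}WV$. -/
theorem sitePrecision_mul (hA : A.PosDef) (hV : IsStableSolvent (swapBlocks A) V)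
    (hW : IsStableSolvent A W) : sitePrecision A V W * V = Wᴴ * sitePrecision A V W := by
  have h1 : innovationPrecision (swapBlocks A) V * V = -blkLR A := innovationPrecision_mul hV
  have h2 := conjTranspose_mul_innovationPrecision hA hW
  conv_rhs => rw [sitePrecision_eq_innovation, mul_add, h2, ← mul_assoc, ← blkLR_mul_eq hA hW]
  rw [sitePrecision_eq_swap, add_mul, h1]

theorem mul_inv_sitePrecision (hA : A.PosDef) (hV : IsStableSolvent (swapBlocks A) V)
    (hW : IsStableSolvent A W) :
    V * (sitePrecision A V W)⁻¹ = (sitePrecision A V W)⁻¹ * Wᴴ := by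
  have hG := isUnit_det_of_posDef (posDef_sitePrecision hA hV hW)
  have h := sitePrecision_mul hA hV hW
  calc V * (sitePrecision A V W)⁻¹
      = (sitePrecision A V W)⁻¹ * (sitePrecision A V W * V) * (sitePrecision A V W)⁻¹ := by
        rw [Matrix.nonsing_inv_mul_cancel_left _ _ hG]
    _ = _ := by
        rw [h, ← mul_assoc, Matrix.mul_nonsing_inv_cancel_right _ _ hG]

/-- Stationarity of the covariance: $G^{-1}$ is its propagation $WG^{-1}W^*$ plus the innovation
covariance. It follows by inserting $G=K+A_{RL}V$ into $K^{-1}GG^{-1}$. -/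
theorem inv_innovationPrecision (hA : A.PosDef) (hV : IsStableSolvent (swapBlocks A) V)
    (hW : IsStableSolvent A W) :
    (innovationPrecision A W)⁻¹
      = (sitePrecision A V W)⁻¹ - W * (sitePrecision A V W)⁻¹ * Wᴴ := by
  have hG := isUnit_det_of_posDef (posDef_sitePrecision hA hV hW)
  have hK := isUnit_det_of_posDef (posDef_innovationPrecision hA hW)
  calc (innovationPrecision A W)⁻¹
      = (innovationPrecision A W)⁻¹ * (sitePrecision A V W * (sitePrecision A V W)⁻¹) := by
        rw [Matrix.mul_nonsing_inv _ hG, mul_one]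
    _ = (innovationPrecision A W)⁻¹ * innovationPrecision A W * (sitePrecision A V W)⁻¹
          + (innovationPrecision A W)⁻¹ * blkRL A * (V * (sitePrecision A V W)⁻¹) := by
        conv_lhs => rw [sitePrecision_eq_innovation, add_mul, mul_add]
        rw [← sitePrecision_eq_innovation]
        simp only [mul_assoc]
    _ = _ := by
        rw [Matrix.nonsing_inv_mul _ hK, eq_neg_inv_mul hA hW, mul_inv_sitePrecision hA hV hW]
        noncomm_ring

/-- The sum telescopes to $G^{-1}-W^kG^{-1}W^{*k}$; the powers of $W^*$ are then carried through $G$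
and become powers of `V`. -/
theorem sum_pow_mul_inv_innovationPrecision (hA : A.PosDef)
    (hV : IsStableSolvent (swapBlocks A) V) (hW : IsStableSolvent A W) (k m : ℕ) :
    (∑ i ∈ Finset.range k, W ^ i * (innovationPrecision A W)⁻¹ * Wᴴ ^ i) * Wᴴ ^ m
      * sitePrecision A V W = V ^ m - W ^ k * V ^ (k + m) := by
  have hG := isUnit_det_of_posDef (posDef_sitePrecision hA hV hW)
  have hs : ∑ i ∈ Finset.range k, W ^ i * (innovationPrecision A W)⁻¹ * Wᴴ ^ i
      = (sitePrecision A V W)⁻¹ - W ^ k * (sitePrecision A V W)⁻¹ * Wᴴ ^ k := by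
    induction k with
    | zero => simp
    | succ k ih =>
      rw [Finset.sum_range_succ, ih, inv_innovationPrecision hA hV hW, pow_succ W, pow_succ' Wᴴ]
      noncomm_ring
  have hp : ∀ n : ℕ, Wᴴ ^ n * sitePrecision A V W = sitePrecision A V W * V ^ n := by
    intro n
    induction n with
    | zero => simp
    | succ n ih =>
      rw [pow_succ, mul_assoc, ← sitePrecision_mul hA hV hW, ← mul_assoc, ih, mul_assoc,
        ← pow_succ]
  rw [hs, mul_assoc, hp, sub_mul, Matrix.nonsing_inv_mul_cancel_left _ _ hG]
  congr 1
  rw [← hp, mul_assoc (W ^ k * _), ← mul_assoc (Wᴴ ^ k), ← pow_add, hp, mul_assoc (W ^ k),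
    Matrix.nonsing_inv_mul_cancel_left _ _ hG]

theorem isUnit_det_blkLR (h : FullRank A) : IsUnit (blkLR A).det := by
  rw [← Matrix.isUnit_iff_isUnit_det, ← Matrix.linearIndependent_rows_iff_isUnit,
    linearIndependent_iff_card_eq_finrank_span, Fintype.card_fin]
  exact h.symm.trans (Matrix.rank_eq_finrank_span_row _)

/-- The companion matrix of the quadratic matrix polynomial of `A`. -/
def companion (A : BlockMatrix d) : BlockMatrix d :=
  Matrix.fromBlocks 0 1 (-((blkLR A)⁻¹ * blkRL A)) (-((blkLR A)⁻¹ * (blkLL A + blkRR A)))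

/-- The Schur complement of the invertible block $z\cdot1$ in $z-{}$`companion A` is
$A_{LR}^{-1}\Phi(z)$. This gives equality at every $z\ne0$, enough for polynomials; the purpose is
to read off the degree $2d$. -/
theorem zeroPoly_eq (hA : IsUnit (blkLR A).det) :
    zeroPoly A = Polynomial.C (blkLR A).det * (companion A).charpoly := by
  refine Polynomial.eq_of_infinite_eval_eq _ _
    ((Set.finite_singleton (0 : ℂ)).infinite_compl.mono fun z hz => ?_)
  have hz : z ≠ 0 := hz
  have h1 : Matrix.scalar (Fin d ⊕ Fin d) z - companion A
      = Matrix.fromBlocks (z • 1) (-1) ((blkLR A)⁻¹ * blkRL A)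
        (z • 1 + (blkLR A)⁻¹ * (blkLL A + blkRR A)) := by
    ext (i | i) (j | j) <;>
      simp [companion, Matrix.one_apply, Matrix.diagonal_apply, sub_eq_add_neg]
  have hu : IsUnit (z • (1 : Matrix (Fin d) (Fin d) ℂ)).det := by
    simp [hz]
  have hinv : (z • (1 : Matrix (Fin d) (Fin d) ℂ))⁻¹ = z⁻¹ • 1 := by
    apply Matrix.inv_eq_left_inv
    simp [smul_smul, hz]
  let _ : Invertible (z • (1 : Matrix (Fin d) (Fin d) ℂ)) := Matrix.invertibleOfIsUnitDet _ hu
  have hphi : z • 1 + (blkLR A)⁻¹ * (blkLL A + blkRR A)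
      - (blkLR A)⁻¹ * blkRL A * ⅟(z • (1 : Matrix (Fin d) (Fin d) ℂ)) * (-1)
      = (blkLR A)⁻¹ * Phi A z := by
    rw [Matrix.invOf_eq_nonsing_inv, hinv, Phi]
    simp only [mul_add, Matrix.mul_smul, Matrix.nonsing_inv_mul _ hA, mul_neg, mul_one]
    abel
  simp only [Set.mem_ofPred_eq]
  rw [zeroPoly_eval A hz, Polynomial.eval_mul, Polynomial.eval_C, Matrix.eval_charpoly, h1,
    Matrix.det_fromBlocks₁₁, hphi, Matrix.det_mul, Matrix.det_nonsing_inv, Matrix.det_smul,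
    Ring.inverse_eq_inv']
  have := hA.ne_zero
  simp
  field_simp

theorem natDegree_zeroPoly (hA : IsUnit (blkLR A).det) : (zeroPoly A).natDegree = d + d := by
  rw [zeroPoly_eq hA, Polynomial.natDegree_C_mul hA.ne_zero, Matrix.charpoly_natDegree_eq_dim]
  simp

theorem eval_zero_zeroPoly (A : BlockMatrix d) : (zeroPoly A).eval 0 = (blkRL A).det := by
  rw [zeroPoly, ← Polynomial.coe_evalRingHom, RingHom.map_det]
  congr 1
  ext i j
  simp

theorem mem_roots_zeroPoly (hA : A.PosDef) (hLR : IsUnit (blkLR A).det) {z : ℂ} :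
    z ∈ (zeroPoly A).roots ↔ z ∈ zeros A := by
  have h0 : zeroPoly A ≠ 0 := by
    rw [zeroPoly_eq hLR]
    exact mul_ne_zero (by simpa using hLR.ne_zero) (Matrix.charpoly_monic _).ne_zero
  rw [Polynomial.mem_roots h0, Polynomial.IsRoot]
  rcases eq_or_ne z 0 with rfl | hz
  -- Zero is not a root: the constant coefficient is $\det A_{RL}$, the conjugate of $\det A_{LR}$.
  · simp only [eval_zero_zeroPoly, blkRL_eq_conjTranspose hA.isHermitian,
      Matrix.det_conjTranspose, zeros, Set.mem_ofPred_eq, ne_eq, not_true, false_and, iff_false]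
    simpa using hLR.ne_zero
  · simp [zeroPoly_eval A hz, zeros, hz]

theorem finite_zeros (hA : A.PosDef) (hLR : IsUnit (blkLR A).det) : (zeros A).Finite := by
  refine ((zeroPoly A).roots.toFinset.finite_toSet).subset fun z hz => ?_
  simpa using (mem_roots_zeroPoly hA hLR).2 hz

theorem ncard_zeros (hA : A.PosDef) (hLR : IsUnit (blkLR A).det) (hs : SimpleZeros A) :
    (zeros A).ncard = d + d := by
  have h1 : zeros A = ((zeroPoly A).roots.toFinset : Set ℂ) := by
    ext z
    simp only [Finset.mem_coe, Multiset.mem_toFinset, mem_roots_zeroPoly hA hLR]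
  have h2 : (zeroPoly A).roots.Nodup := by
    rw [Multiset.nodup_iff_count_le_one]
    intro z
    rw [Polynomial.count_roots]
    by_cases hz : z ∈ zeros A
    · exact (hs z hz).1.le
    · rw [← Polynomial.count_roots, Multiset.count_eq_zero_of_notMem]
      · exact zero_le_one
      · rwa [mem_roots_zeroPoly hA hLR]
  rw [h1, Set.ncard_coe_finset, Multiset.toFinset_card_of_nodup h2,
    ← (IsAlgClosed.splits (zeroPoly A)).natDegree_eq_card_roots, natDegree_zeroPoly hLR]

/-- On the unit circle $z^{-1}=\bar z$. Positivity of `A` therefore excludes zeros there. -/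
theorem star_dotProduct_Phi_mulVec {z : ℂ} (hz : ‖z‖ = 1) (x : Fin d → ℂ) :
    star x ⬝ᵥ (Phi A z *ᵥ x) = energy A x (z • x) := by
  have h1 : star z * z = 1 := by
    have := Complex.normSq_eq_conj_mul_self (z := z)
    rw [Complex.normSq_eq_norm_sq, hz] at this
    simpa using this.symm
  have h2 : z⁻¹ = star z := (eq_inv_of_mul_eq_one_left h1).symm
  rw [energy_eq, Phi, h2]
  simp only [Matrix.add_mulVec, Matrix.smul_mulVec, Matrix.mulVec_smul, dotProduct_add,
    dotProduct_smul, star_smul, smul_dotProduct, smul_eq_mul]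
  linear_combination (-(star x ⬝ᵥ blkRR A *ᵥ x)) * h1

theorem det_Phi_ne_zero (hA : A.PosDef) {z : ℂ} (hz : ‖z‖ = 1) : (Phi A z).det ≠ 0 := by
  intro h
  obtain ⟨x, hx, h0⟩ := Matrix.exists_mulVec_eq_zero_iff.2 h
  have h1 := energy_pos hA (x := x) (y := z • x) (Or.inl hx)
  rw [← star_dotProduct_Phi_mulVec hz, h0] at h1
  simp at h1

theorem zeros_eq_union (hA : A.PosDef) : zeros A = zerosIn A ∪ zerosOut A := by
  ext w
  constructor
  · intro h
    rcases lt_trichotomy ‖w‖ 1 with h1 | h1 | h1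
    · exact Or.inl ⟨h, h1⟩
    · exact absurd h.2 (det_Phi_ne_zero hA h1)
    · exact Or.inr ⟨h, h1⟩
  · rintro (h | h) <;> exact h.1

theorem isPencilVec_of_Phi {w : ℂ} (hw : w ≠ 0) {v : Fin d → ℂ} (h : Phi A w *ᵥ v = 0) :
    IsPencilVec A w v := by
  have := congrArg (fun x => w • x) h
  simp only [Phi, Matrix.add_mulVec, Matrix.smul_mulVec, smul_add, smul_smul, mul_inv_cancel₀ hw,
    one_smul, smul_zero] at this
  rw [IsPencilVec, ← this, Matrix.add_mulVec, smul_add, sq]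
  abel

/-- Exchanging left and right replaces $w$ by $w^{-1}$, so zeros outside the disk are treated as
zeros inside it. -/
theorem isPencilVec_swapBlocks_of_Phi {w : ℂ} (hw : w ≠ 0) {v : Fin d → ℂ}
    (h : Phi A w *ᵥ v = 0) : IsPencilVec (swapBlocks A) w⁻¹ v := by
  refine isPencilVec_of_Phi (inv_ne_zero hw) ?_
  rw [← h, Phi, Phi, inv_inv]
  congr 1
  have h1 : blkLL (swapBlocks A) = blkRR A := rfl
  have h2 : blkRR (swapBlocks A) = blkLL A := rfl
  have h3 : blkLR (swapBlocks A) = blkRL A := rfl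
  have h4 : blkRL (swapBlocks A) = blkLR A := rfl
  rw [h1, h2, h3, h4]
  abel

theorem Phi_mulVec_eq_zero {u : ℂ → Fin d → ℂ} (hu : SpansKernels A u) {w : ℂ}
    (hw : w ∈ zeros A) : Phi A w *ᵥ u w = 0 := by
  have : u w ∈ LinearMap.ker (Phi A w).mulVecLin := by
    rw [(hu w hw).2]; exact Submodule.mem_span_singleton_self _
  simpa using this

theorem linearIndependent_zerosIn (hA : A.PosDef) {u : ℂ → Fin d → ℂ} (hu : SpansKernels A u)
    [Fintype (zerosIn A)] : LinearIndependent ℂ fun w : zerosIn A => u w :=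
  linearIndependent_of_isPencilVec hA (w := fun w : zerosIn A => (w : ℂ))
    Subtype.coe_injective (fun w => w.2.2) (fun w => (hu w w.2.1).1)
    fun w => isPencilVec_of_Phi w.2.1.1 (Phi_mulVec_eq_zero hu w.2.1)

theorem norm_inv_lt_one_of_mem_zerosOut (w : zerosOut A) : ‖(w : ℂ)⁻¹‖ < 1 := by
  rw [norm_inv]
  exact inv_lt_one_of_one_lt₀ w.2.2

theorem linearIndependent_zerosOut (hA : A.PosDef) {u : ℂ → Fin d → ℂ} (hu : SpansKernels A u)
    [Fintype (zerosOut A)] : LinearIndependent ℂ fun w : zerosOut A => u w :=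
  linearIndependent_of_isPencilVec (posDef_swapBlocks hA)
    (w := fun w : zerosOut A => (w : ℂ)⁻¹)
    (inv_injective.comp Subtype.coe_injective) norm_inv_lt_one_of_mem_zerosOut
    (fun w => (hu w w.2.1).1)
    fun w => isPencilVec_swapBlocks_of_Phi w.2.1.1 (Phi_mulVec_eq_zero hu w.2.1)

theorem exists_basis_of_card {S : Set ℂ} [Fintype S] {u : ℂ → Fin d → ℂ}
    (h : LinearIndependent ℂ fun w : S => u w) (hc : S.ncard = d) :
    ∃ b : Module.Basis S ℂ (Fin d → ℂ), ∀ w : S, b w = u w := by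
  have hc' : Fintype.card S = Module.finrank ℂ (Fin d → ℂ) := by
    rw [Module.finrank_fin_fun, ← Nat.card_eq_fintype_card]; exact hc
  exact ⟨basisOfLinearIndependentOfCardEqFinrank' _ h hc', fun w => by simp⟩

/-- Independence bounds each family by $d$, while the two together have $2d$ elements; both bounds
are therefore attained. -/
theorem exists_bases (hA : A.PosDef) (hfull : FullRank A) (hs : SimpleZeros A)
    {u : ℂ → Fin d → ℂ} (hu : SpansKernels A u) :
    (∃ b : Module.Basis (zerosIn A) ℂ (Fin d → ℂ), ∀ w : zerosIn A, b w = u w) ∧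
    ∃ b : Module.Basis (zerosOut A) ℂ (Fin d → ℂ), ∀ w : zerosOut A, b w = u w := by
  have hLR := isUnit_det_blkLR hfull
  have hfin := finite_zeros hA hLR
  have fIn : (zerosIn A).Finite := hfin.subset fun w h => h.1
  have fOut : (zerosOut A).Finite := hfin.subset fun w h => h.1
  let _ := fIn.fintype
  let _ := fOut.fintype
  have lIn := linearIndependent_zerosIn hA hu
  have lOut := linearIndependent_zerosOut hA hu
  have cIn : (zerosIn A).ncard ≤ d :=
     (Nat.card_eq_fintype_card (α := zerosIn A)).trans_le
      (lIn.fintype_card_le_finrank.trans_eq (Module.finrank_fin_fun ℂ))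
  have cOut : (zerosOut A).ncard ≤ d :=
     (Nat.card_eq_fintype_card (α := zerosOut A)).trans_le
      (lOut.fintype_card_le_finrank.trans_eq (Module.finrank_fin_fun ℂ))
  have hdisj : Disjoint (zerosIn A) (zerosOut A) :=
    Set.disjoint_left.2 fun w h1 h2 => lt_asymm h1.2 h2.2
  have hsum := ncard_zeros hA hLR hs
  rw [zeros_eq_union hA, Set.ncard_union_eq hdisj fIn fOut] at hsum
  exact ⟨exists_basis_of_card lIn (by omega), exists_basis_of_card lOut (by omega)⟩

theorem isStableSolvent_diagIn (hfull : FullRank A) (hA : A.PosDef) {u : ℂ → Fin d → ℂ}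
    (hu : SpansKernels A u) (b : Module.Basis (zerosIn A) ℂ (Fin d → ℂ))
    (hb : ∀ w : zerosIn A, b w = u w) : IsStableSolvent A (diagIn b) := by
  let _ := ((finite_zeros hA (isUnit_det_blkLR hfull)).subset
    (fun w h => h.1 : zerosIn A ⊆ zeros A)).fintype
  refine isStableSolvent_of_basis (w := fun w : zerosIn A => (w : ℂ)) (fun w => w.2.2) b
    (fun w => ?_) (diagIn_mulVec b)
  rw [hb]
  exact isPencilVec_of_Phi w.2.1.1 (Phi_mulVec_eq_zero hu w.2.1)

/-- A matrix that is diagonal in a basis, with non-zero eigenvalues, is invertible. -/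
theorem isUnit_det_diagIn {S : Set ℂ} (hS : ∀ w ∈ S, w ≠ 0)
    (b : Module.Basis S ℂ (Fin d → ℂ)) : IsUnit (diagIn b).det := by
  have h : LinearMap.toMatrix' (b.constr ℂ fun w : S => (w : ℂ)⁻¹ • b w) * diagIn b = 1 := by
    rw [diagIn, ← LinearMap.toMatrix'_comp, ← LinearMap.toMatrix'_id]
    congr 1
    refine b.ext fun w => ?_
    simp [Module.Basis.constr_basis, smul_smul, hS w w.2]
  exact (Matrix.isUnit_iff_isUnit_det _).1 (IsUnit.of_mul_eq_one_right _ h)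

theorem inv_diagIn_mulVec {S : Set ℂ} (hS : ∀ w ∈ S, w ≠ 0)
    (b : Module.Basis S ℂ (Fin d → ℂ)) (w : S) :
    (diagIn b)⁻¹ *ᵥ b w = (w : ℂ)⁻¹ • b w := by
  have h := congrArg (fun x => (w : ℂ)⁻¹ • ((diagIn b)⁻¹ *ᵥ x)) (diagIn_mulVec b w)
  simp only [Matrix.mulVec_mulVec, Matrix.nonsing_inv_mul _ (isUnit_det_diagIn hS b),
    Matrix.one_mulVec, Matrix.mulVec_smul, smul_smul, inv_mul_cancel₀ (hS w w.2), one_smul] at h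
  exact h.symm

theorem isStableSolvent_inv_diagIn (hfull : FullRank A) (hA : A.PosDef) {u : ℂ → Fin d → ℂ}
    (hu : SpansKernels A u) (b : Module.Basis (zerosOut A) ℂ (Fin d → ℂ))
    (hb : ∀ w : zerosOut A, b w = u w) : IsStableSolvent (swapBlocks A) (diagIn b)⁻¹ := by
  let _ := ((finite_zeros hA (isUnit_det_blkLR hfull)).subset
    (fun w h => h.1 : zerosOut A ⊆ zeros A)).fintype
  refine isStableSolvent_of_basis norm_inv_lt_one_of_mem_zerosOut b
    (fun w => ?_) (inv_diagIn_mulVec (fun w h => h.1.1) b)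
  rw [hb]
  exact isPencilVec_swapBlocks_of_Phi w.2.1.1 (Phi_mulVec_eq_zero hu w.2.1)

theorem mulVec_eq_finsum {S : Set ℂ} (hS : S.Finite) (b : Module.Basis S ℂ (Fin d → ℂ))
    {B : Matrix (Fin d) (Fin d) ℂ} {f : ℂ → ℂ} (h : ∀ w : S, B *ᵥ b w = f w • b w)
    (x : Fin d → ℂ) : B *ᵥ x = ∑ᶠ w : S, (f w * b.repr x w) • b w := by
  let _ := hS.fintype
  rw [finsum_eq_sum_of_fintype]
  conv_lhs => rw [← b.sum_repr x]
  simp only [Matrix.mulVec_sum, Matrix.mulVec_smul, h, smul_smul, mul_comm]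

end GaussMarkov
end

/-! ### Laurent expansion of the inverse symbol and its Fourier coefficients. -/

noncomputable section

open Filter Topology Matrix

namespace GaussMarkov

variable {d : ℕ} {A : BlockMatrix d} {V W : Matrix (Fin d) (Fin d) ℂ}

/-- The boundary terms left over by a truncated geometric series of a solvent. -/
def truncationError (A : BlockMatrix d) (W : Matrix (Fin d) (Fin d) ℂ) (z : ℂ) (N : ℕ) :
    Matrix (Fin d) (Fin d) ℂ :=
  z ^ (N + 1) • (blkRL A * W ^ N) - z ^ N • (blkLR A * W ^ (N + 1))

/-- Coefficients of $z^k$ away from the two ends are the quadratic equation times a power of `W`, so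
only end terms survive. -/
theorem Phi_inv_mul_geomSum (hW : IsStableSolvent A W) {z : ℂ} (hz : z ≠ 0) (N : ℕ) :
    Phi A z⁻¹ * ∑ k ∈ Finset.range (N + 1), z ^ k • W ^ k
      = blkLL A + blkRR A + z⁻¹ • blkLR A + blkLR A * W + truncationError A W z N := by
  have h : ∀ N : ℕ, blkRL A * W ^ N + (blkLL A + blkRR A) * W ^ (N + 1)
      + blkLR A * W ^ (N + 2) = 0 := by
    intro N
    have := congrArg (fun B => B * W ^ N) hW.eq
    simpa only [add_mul, zero_mul, mul_assoc, ← pow_succ', ← pow_succ] using this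
  have hphi : ∀ B, Phi A z⁻¹ * B
      = (blkLL A + blkRR A) * B + z⁻¹ • (blkLR A * B) + z • (blkRL A * B) := by
    intro B
    rw [Phi, inv_inv, add_mul, add_mul, Matrix.smul_mul, Matrix.smul_mul]
  induction N with
  | zero =>
    simp only [truncationError, hphi, zero_add, Finset.range_one, Finset.sum_singleton, pow_zero,
      pow_one, one_smul, mul_one]
    abel
  | succ N ih =>
    rw [Finset.sum_range_succ, mul_add, ih, hphi, truncationError, truncationError]
    have h1 : (blkLL A + blkRR A) * W ^ (N + 1)
        = -(blkRL A * W ^ N) - blkLR A * W ^ (N + 2) := by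
      rw [← sub_eq_zero, ← h N]; abel
    have h2 : z⁻¹ * z ^ (N + 1) = z ^ N := by
      rw [pow_succ, mul_comm, mul_assoc, mul_inv_cancel₀ hz, mul_one]
    simp only [Matrix.mul_smul, h1, smul_smul, h2, smul_sub, smul_neg, ← pow_succ',
      show N + 1 + 1 = N + 2 from rfl]
    abel

/-- The truncated Laurent series of `Φ_A⁻¹` on the unit circle. -/
def laurentSum (A : BlockMatrix d) (V W : Matrix (Fin d) (Fin d) ℂ) (z : ℂ) (N : ℕ) :
    Matrix (Fin d) (Fin d) ℂ :=
  (∑ k ∈ Finset.range (N + 1), z ^ k • V ^ k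
    + ∑ k ∈ Finset.range N, z⁻¹ ^ (k + 1) • W ^ (k + 1)) * (sitePrecision A V W)⁻¹

theorem Phi_swapBlocks (A : BlockMatrix d) (z : ℂ) : Phi (swapBlocks A) z⁻¹ = Phi A z := by
  have h1 : blkLL (swapBlocks A) = blkRR A := rfl
  have h2 : blkRR (swapBlocks A) = blkLL A := rfl
  have h3 : blkLR (swapBlocks A) = blkRL A := rfl
  have h4 : blkRL (swapBlocks A) = blkLR A := rfl
  rw [Phi, Phi, h1, h2, h3, h4, inv_inv]
  abel

/-- Adding the two geometric identities counts the exponent $0$ twice; removing one copy of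
$\Phi(z)$ leaves $A_{LL}+A_{RR}+A_{RL}V+A_{LR}W=G$. -/
theorem Phi_mul_laurentSum (hA : A.PosDef) (hV : IsStableSolvent (swapBlocks A) V)
    (hW : IsStableSolvent A W) {z : ℂ} (hz : z ≠ 0) (N : ℕ) :
    Phi A z * laurentSum A V W z N
      = 1 + (truncationError (swapBlocks A) V z N + truncationError A W z⁻¹ N)
        * (sitePrecision A V W)⁻¹ := by
  have hG := isUnit_det_of_posDef (posDef_sitePrecision hA hV hW)
  have h1 := Phi_inv_mul_geomSum hV hz N
  have h2 := Phi_inv_mul_geomSum hW (inv_ne_zero hz) N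
  rw [Phi_swapBlocks] at h1
  rw [inv_inv, Finset.sum_range_succ', mul_add, pow_zero, pow_zero, one_smul, mul_one] at h2
  have h3 : ∀ B E, Phi A z * B + Phi A z = E → Phi A z * B = E - Phi A z :=
    fun B E h => eq_sub_of_add_eq h
  rw [laurentSum, ← mul_assoc, mul_add, h1, h3 _ _ h2, ← Matrix.mul_nonsing_inv _ hG, ← add_mul]
  congr 1
  have e1 : blkLL (swapBlocks A) = blkRR A := rfl
  have e2 : blkRR (swapBlocks A) = blkLL A := rfl
  have e3 : blkLR (swapBlocks A) = blkRL A := rfl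
  rw [sitePrecision, rightBoundary, rightBoundary, Phi, e1, e2, e3]
  abel

section Norm

attribute [local instance] Matrix.linftyOpNormedRing Matrix.linftyOpNormedAlgebra

theorem norm_entry_le (B : Matrix (Fin d) (Fin d) ℂ) (i j : Fin d) : ‖B i j‖ ≤ ‖B‖ := by
  rw [Matrix.linfty_opNorm_def]
  have h : ‖B i j‖₊ ≤ Finset.univ.sup fun i => ∑ j, ‖B i j‖₊ :=
    (Finset.single_le_sum (f := fun j => ‖B i j‖₊) (fun _ _ => zero_le) (Finset.mem_univ j)).trans
      (Finset.le_sup (f := fun i => ∑ j, ‖B i j‖₊) (Finset.mem_univ i))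
  exact_mod_cast h

theorem exists_norm_truncationError_le (hW : IsStableSolvent A W) :
    ∃ e : ℕ → ℝ, Tendsto e atTop (𝓝 0) ∧
      ∀ z : ℂ, ‖z‖ = 1 → ∀ N, ‖truncationError A W z N‖ ≤ e N := by
  refine ⟨fun N => ‖blkRL A * W ^ N‖ + ‖blkLR A * W ^ (N + 1)‖, ?_, fun z hz N => ?_⟩
  · have h1 : Tendsto (fun N => W ^ N) atTop (𝓝 0) := hW.tendsto
    have h2 := (h1.const_mul (blkRL A)).norm
    have h3 := ((h1.comp (tendsto_add_atTop_nat 1)).const_mul (blkLR A)).norm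
    simpa using h2.add h3
  · refine (norm_sub_le _ _).trans (le_of_eq ?_)
    rw [norm_smul, norm_smul, norm_pow, norm_pow, hz, one_pow, one_pow, one_mul, one_mul]

theorem continuous_inv_Phi (hA : A.PosDef) :
    Continuous fun θ : ℝ => (Phi A (Complex.exp (Complex.I * θ)))⁻¹ := by
  have hc : Continuous fun θ : ℝ => Phi A (Complex.exp (Complex.I * θ)) := by
    unfold Phi
    have h1 : Continuous fun θ : ℝ => Complex.exp (Complex.I * θ) := by fun_prop
    have h2 : Continuous fun θ : ℝ => (Complex.exp (Complex.I * θ))⁻¹ :=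
      h1.inv₀ fun θ => Complex.exp_ne_zero _
    fun_prop
  simp only [Matrix.inv_def, Ring.inverse_eq_inv']
  refine Continuous.smul (hc.matrix_det.inv₀ fun θ => det_Phi_ne_zero hA ?_) hc.matrix_adjugate
  rw [mul_comm, Complex.norm_exp_ofReal_mul_I]

/-- In a submultiplicative norm the truncation error is bounded uniformly on the circle by a null
sequence. Multiplying by $\Phi^{-1}$, which is continuous there, gives both pointwise convergence
and a continuous dominating function. -/
theorem tendsto_integral_laurentSum (hA : A.PosDef) (hV : IsStableSolvent (swapBlocks A) V)
    (hW : IsStableSolvent A W) (k : ℤ) (i j : Fin d) :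
    Tendsto (fun N => ∫ θ in (0 : ℝ)..(2 * Real.pi),
        laurentSum A V W (Complex.exp (Complex.I * θ)) N i j * Complex.exp (-(Complex.I * k * θ)))
      atTop (𝓝 (∫ θ in (0 : ℝ)..(2 * Real.pi),
        (Phi A (Complex.exp (Complex.I * θ)))⁻¹ i j * Complex.exp (-(Complex.I * k * θ)))) := by
  obtain ⟨e, he, hle⟩ := exists_norm_truncationError_le hV
  obtain ⟨f, hf, hlf⟩ := exists_norm_truncationError_le hW
  have hz : ∀ θ : ℝ, ‖Complex.exp (Complex.I * θ)‖ = 1 := fun θ => by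
    rw [mul_comm, Complex.norm_exp_ofReal_mul_I]
  have hk : ∀ θ : ℝ, ‖Complex.exp (-(Complex.I * k * θ))‖ = 1 := fun θ => by
    have : -(Complex.I * k * θ) = ((-(k * θ) : ℝ) : ℂ) * Complex.I := by push_cast; ring
    rw [this, Complex.norm_exp_ofReal_mul_I]
  set G := (sitePrecision A V W)⁻¹ with hG
  have hdiff : ∀ (θ : ℝ) (N : ℕ),
      ‖laurentSum A V W (Complex.exp (Complex.I * θ)) N - (Phi A (Complex.exp (Complex.I * θ)))⁻¹‖
        ≤ ‖(Phi A (Complex.exp (Complex.I * θ)))⁻¹‖ * ((e N + f N) * ‖G‖) := by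
    intro θ N
    have hu : IsUnit (Phi A (Complex.exp (Complex.I * θ))).det :=
      (det_Phi_ne_zero hA (hz θ)).isUnit
    have h := congrArg (fun B => (Phi A (Complex.exp (Complex.I * θ)))⁻¹ * B)
      (Phi_mul_laurentSum hA hV hW (Complex.exp_ne_zero (Complex.I * θ)) N)
    simp only [Matrix.nonsing_inv_mul_cancel_left _ _ hu, mul_add, mul_one] at h
    rw [h, add_sub_cancel_left]
    refine (norm_mul_le _ _).trans (mul_le_mul_of_nonneg_left ?_ (norm_nonneg _))
    refine (norm_mul_le _ _).trans (mul_le_mul_of_nonneg_right ?_ (norm_nonneg _))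
    exact (norm_add_le _ _).trans (add_le_add (hle _ (hz θ) N)
      (hlf _ (by rw [norm_inv, hz, inv_one]) N))
  have hef : Tendsto (fun N => (e N + f N) * ‖G‖) atTop (𝓝 0) := by
    simpa using (he.add hf).mul_const ‖G‖
  obtain ⟨C, hC⟩ := hef.bddAbove_range
  have hC : ∀ N, (e N + f N) * ‖G‖ ≤ C := fun N => hC (Set.mem_range_self N)
  have hcont := continuous_inv_Phi hA
  refine intervalIntegral.tendsto_integral_filter_of_dominated_convergence
    (fun θ => ‖(Phi A (Complex.exp (Complex.I * θ)))⁻¹‖ * C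
      + ‖(Phi A (Complex.exp (Complex.I * θ)))⁻¹‖) ?_ ?_ ?_ ?_
  · refine Eventually.of_forall fun N => Continuous.aestronglyMeasurable ?_
    have h1 : Continuous fun θ : ℝ => Complex.exp (Complex.I * θ) := by fun_prop
    have h2 : Continuous fun θ : ℝ => (Complex.exp (Complex.I * θ))⁻¹ :=
      h1.inv₀ fun θ => Complex.exp_ne_zero _
    have h3 : Continuous fun θ : ℝ => laurentSum A V W (Complex.exp (Complex.I * θ)) N := by
      unfold laurentSum
      fun_prop
    exact (h3.matrix_elem i j).mul (by fun_prop)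
  · refine Eventually.of_forall fun N => Eventually.of_forall fun θ _ => ?_
    rw [norm_mul, hk, mul_one]
    refine (norm_entry_le _ i j).trans ?_
    have := norm_add_le (laurentSum A V W (Complex.exp (Complex.I * θ)) N
      - (Phi A (Complex.exp (Complex.I * θ)))⁻¹) (Phi A (Complex.exp (Complex.I * θ)))⁻¹
    rw [sub_add_cancel] at this
    refine this.trans (add_le_add_left ((hdiff θ N).trans ?_) _)
    exact mul_le_mul_of_nonneg_left (hC N) (norm_nonneg _)
  · exact (Continuous.add (hcont.norm.mul continuous_const) hcont.norm).intervalIntegrable _ _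
  · refine Eventually.of_forall fun θ _ => Tendsto.mul_const _ ?_
    rw [tendsto_iff_norm_sub_tendsto_zero]
    refine squeeze_zero (fun _ => norm_nonneg _)
      (fun N => (norm_entry_le (laurentSum A V W (Complex.exp (Complex.I * θ)) N
        - (Phi A (Complex.exp (Complex.I * θ)))⁻¹) i j).trans (hdiff θ N)) ?_
    simpa using hef.const_mul ‖(Phi A (Complex.exp (Complex.I * θ)))⁻¹‖

end Norm

theorem integral_exp_mul_exp (m k : ℤ) :
    ∫ θ in (0 : ℝ)..(2 * Real.pi), Complex.exp (Complex.I * θ) ^ m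
      * Complex.exp (-(Complex.I * k * θ)) = if m = k then 2 * (Real.pi : ℂ) else 0 := by
  have h : ∀ θ : ℝ, Complex.exp (Complex.I * θ) ^ m * Complex.exp (-(Complex.I * k * θ))
      = Complex.exp (((m - k : ℤ) : ℂ) * Complex.I * θ) := by
    intro θ
    rw [← Complex.exp_int_mul, ← Complex.exp_add]
    congr 1
    push_cast
    ring
  simp only [h]
  split_ifs with hmk
  · simp [hmk]
  · have hne : ((m - k : ℤ) : ℂ) * Complex.I ≠ 0 :=
      mul_ne_zero (by exact_mod_cast sub_ne_zero.2 hmk) Complex.I_ne_zero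
    rw [integral_exp_mul_complex hne]
    have : ((m - k : ℤ) : ℂ) * Complex.I * ((2 * Real.pi : ℝ) : ℂ)
        = ((m - k : ℤ) : ℂ) * (2 * Real.pi * Complex.I) := by push_cast; ring
    rw [this, Complex.exp_int_mul_two_pi_mul_I]
    simp

theorem integral_laurentSum (k : ℤ) (N : ℕ) (i j : Fin d) :
    ∫ θ in (0 : ℝ)..(2 * Real.pi),
        laurentSum A V W (Complex.exp (Complex.I * θ)) N i j * Complex.exp (-(Complex.I * k * θ))
      = ∑ m ∈ Finset.range (N + 1),
          (V ^ m * (sitePrecision A V W)⁻¹) i j * (if (m : ℤ) = k then 2 * (Real.pi : ℂ) else 0)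
        + ∑ m ∈ Finset.range N, (W ^ (m + 1) * (sitePrecision A V W)⁻¹) i j
          * (if -((m : ℤ) + 1) = k then 2 * (Real.pi : ℂ) else 0) := by
  have hcont : ∀ m : ℤ, Continuous fun θ : ℝ => Complex.exp (Complex.I * θ) ^ m
      * Complex.exp (-(Complex.I * k * θ)) := by
    intro m
    have h1 : Continuous fun θ : ℝ => Complex.exp (Complex.I * θ) ^ m :=
      Continuous.zpow₀ (by fun_prop) m fun θ => Or.inl (Complex.exp_ne_zero _)
    fun_prop
  have hint : ∀ (c : ℂ) (m : ℤ), IntervalIntegrable (fun θ : ℝ =>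
      c * (Complex.exp (Complex.I * θ) ^ m * Complex.exp (-(Complex.I * k * θ)))) volume 0
        (2 * Real.pi) :=
    fun c m => ((hcont m).const_mul c).intervalIntegrable _ _
  have h : ∀ θ : ℝ,
      laurentSum A V W (Complex.exp (Complex.I * θ)) N i j * Complex.exp (-(Complex.I * k * θ))
      = ∑ m ∈ Finset.range (N + 1), (V ^ m * (sitePrecision A V W)⁻¹) i j
          * (Complex.exp (Complex.I * θ) ^ (m : ℤ) * Complex.exp (-(Complex.I * k * θ)))
        + ∑ m ∈ Finset.range N, (W ^ (m + 1) * (sitePrecision A V W)⁻¹) i j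
          * (Complex.exp (Complex.I * θ) ^ (-((m : ℤ) + 1))
            * Complex.exp (-(Complex.I * k * θ))) := by
    intro θ
    have hz : ∀ m : ℕ, Complex.exp (Complex.I * θ) ^ (-((m : ℤ) + 1))
        = (Complex.exp (Complex.I * θ))⁻¹ ^ (m + 1) := by
      intro m
      rw [_root_.zpow_neg, inv_pow]
      norm_cast
    simp only [hz, zpow_natCast, laurentSum, add_mul, Finset.sum_mul, Matrix.add_apply,
      Matrix.sum_apply, Matrix.smul_mul, Matrix.smul_apply, smul_eq_mul]
    congr 1 <;> exact Finset.sum_congr rfl fun m _ => by ring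
  simp only [h]
  rw [intervalIntegral.integral_add, intervalIntegral.integral_finsetSum,
    intervalIntegral.integral_finsetSum]
  · simp only [intervalIntegral.integral_const_mul, integral_exp_mul_exp]
  · exact fun m _ => hint _ _
  · exact fun m _ => hint _ _
  · exact (continuous_finsetSum _ fun m _ => (hcont _).const_mul _).intervalIntegrable _ _
  · exact (continuous_finsetSum _ fun m _ => (hcont _).const_mul _).intervalIntegrable _ _

/-- For fixed $k$ orthogonality of the exponentials makes the truncated integrals constant once $N$
is large, so the limit is that constant. -/
theorem fourierC_apply_of_eventually (hA : A.PosDef) (hV : IsStableSolvent (swapBlocks A) V)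
    (hW : IsStableSolvent A W) {k : ℤ} {B : Matrix (Fin d) (Fin d) ℂ}
    (h : ∀ i j, ∀ᶠ N : ℕ in atTop, ∑ m ∈ Finset.range (N + 1),
          (V ^ m * (sitePrecision A V W)⁻¹) i j * (if (m : ℤ) = k then 2 * (Real.pi : ℂ) else 0)
        + ∑ m ∈ Finset.range N, (W ^ (m + 1) * (sitePrecision A V W)⁻¹) i j
          * (if -((m : ℤ) + 1) = k then 2 * (Real.pi : ℂ) else 0) = B i j * (2 * Real.pi)) :
    fourierC A k = B := by
  ext i j
  have h1 := tendsto_integral_laurentSum hA hV hW k i j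
  simp only [integral_laurentSum] at h1
  have h2 := tendsto_nhds_unique h1 (tendsto_const_nhds.congr' ((h i j).mono fun N hN => hN.symm))
  rw [fourierC, Matrix.of_apply, h2]
  have := Real.pi_ne_zero
  field_simp

theorem fourierC_natCast (hA : A.PosDef) (hV : IsStableSolvent (swapBlocks A) V)
    (hW : IsStableSolvent A W) (k : ℕ) :
    fourierC A k = V ^ k * (sitePrecision A V W)⁻¹ := by
  refine fourierC_apply_of_eventually hA hV hW fun i j => eventually_atTop.2 ⟨k, fun N hN => ?_⟩
  have h1 : ∀ m : ℕ, (-((m : ℤ) + 1) = k) = False := fun m => eq_false (by omega)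
  simp only [h1, if_false, mul_zero, Finset.sum_const_zero, add_zero, Nat.cast_inj, mul_ite,
    Finset.sum_ite_eq', Finset.mem_range, Nat.lt_succ_of_le hN, if_true]

theorem fourierC_neg_natCast (hA : A.PosDef) (hV : IsStableSolvent (swapBlocks A) V)
    (hW : IsStableSolvent A W) (k : ℕ) :
    fourierC A (-(k : ℤ)) = W ^ k * (sitePrecision A V W)⁻¹ := by
  cases k with
  -- The `W` half of the Laurent sum starts at exponent $-1$; exponent $0$ belongs to the `V` half.
  | zero => simpa using fourierC_natCast hA hV hW 0
  | succ k =>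
    refine fourierC_apply_of_eventually hA hV hW fun i j =>
      eventually_atTop.2 ⟨k + 1, fun N hN => ?_⟩
    have h1 : ∀ m : ℕ, ((m : ℤ) = -((k + 1 : ℕ) : ℤ)) = False := fun m => eq_false (by omega)
    have h2 : ∀ m : ℕ, (-((m : ℤ) + 1) = -((k + 1 : ℕ) : ℤ)) = (m = k) :=
      fun m => propext (by omega)
    simp only [h1, h2, if_false, mul_zero, Finset.sum_const_zero, zero_add, mul_ite,
      Finset.sum_ite_eq', Finset.mem_range, Nat.lt_of_succ_le hN, if_true]

end GaussMarkov
end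

/-! ### Moments of unnormalized complex Gaussian measures. -/

noncomputable section

open Filter Topology Matrix

namespace GaussMarkov

variable {d : ℕ}

/-- The Gaussian weight `exp(-½ y^* K y)`. -/
def gaussWeight (K : Matrix (Fin d) (Fin d) ℂ) (y : Fin d → ℂ) : ℝ :=
  Real.exp (-(1 / 2) * (star y ⬝ᵥ (K *ᵥ y)).re)

/-- The unnormalized Gaussian measure with precision matrix `K`. -/
def gaussMeasure (K : Matrix (Fin d) (Fin d) ℂ) : Measure (Fin d → ℂ) :=
  volume.withDensity fun y => ENNReal.ofReal (gaussWeight K y)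

theorem continuous_gaussWeight (K : Matrix (Fin d) (Fin d) ℂ) : Continuous (gaussWeight K) := by
  unfold gaussWeight
  fun_prop

theorem gaussWeight_nonneg (K : Matrix (Fin d) (Fin d) ℂ) (y : Fin d → ℂ) :
    0 ≤ gaussWeight K y :=
  (Real.exp_pos _).le

theorem integral_norm_sq_mul_exp :
    ∫ z : ℂ, ‖z‖ ^ 2 * Real.exp (-(1 / 2) * ‖z‖ ^ 2) = 4 * Real.pi := by
  have h := Complex.integral_rpow_mul_exp_neg_mul_rpow (p := 2) (q := 2) (b := 1 / 2)
    (by norm_num) (by norm_num) (by norm_num)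
  have e1 : (-(2 + 2) / 2 : ℝ) = -2 := by norm_num
  have e2 : ((2 + 2) / 2 : ℝ) = 1 + 1 := by norm_num
  rw [e1, e2, Real.Gamma_add_one one_ne_zero, Real.Gamma_one, Real.rpow_neg (by norm_num)] at h
  simp only [Real.rpow_two] at h
  rw [h]
  ring

theorem integral_exp_neg_half_norm_sq :
    ∫ z : ℂ, Real.exp (-(1 / 2) * ‖z‖ ^ 2) = 2 * Real.pi := by
  have h := Complex.integral_exp_neg_mul_rpow (p := 2) (b := 1 / 2) (by norm_num) (by norm_num)
  have e1 : (-2 / 2 : ℝ) = -1 := by norm_num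
  have e2 : (2 / 2 + 1 : ℝ) = 1 + 1 := by norm_num
  rw [e1, e2, Real.Gamma_add_one one_ne_zero, Real.Gamma_one, Real.rpow_neg_one] at h
  simp only [Real.rpow_two] at h
  rw [h]
  ring

theorem integrable_exp_neg_half_norm_sq :
    Integrable fun z : ℂ => Real.exp (-(1 / 2) * ‖z‖ ^ 2) := by
  -- The integral of a non-integrable function is zero by convention, so the nonzero value already
  -- computed proves integrability.
  by_contra h
  have := integral_exp_neg_half_norm_sq
  rw [integral_undef h] at this
  exact absurd this.symm (by positivity)

theorem integrable_norm_sq_mul_exp :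
    Integrable fun z : ℂ => ‖z‖ ^ 2 * Real.exp (-(1 / 2) * ‖z‖ ^ 2) := by
  by_contra h
  have := integral_norm_sq_mul_exp
  rw [integral_undef h] at this
  exact absurd this.symm (by positivity)

theorem integrable_norm_mul_exp :
    Integrable fun z : ℂ => ‖z‖ * Real.exp (-(1 / 2) * ‖z‖ ^ 2) := by
  refine (integrable_exp_neg_half_norm_sq.add integrable_norm_sq_mul_exp).mono'
    (Continuous.aestronglyMeasurable (by fun_prop)) (Eventually.of_forall fun z => ?_)
  rw [Real.norm_of_nonneg (by positivity), Pi.add_apply]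
  nlinarith [Real.exp_pos (-(1 / 2) * ‖z‖ ^ 2), sq_nonneg (‖z‖ - 1), sq_nonneg (‖z‖ + 1)]

/-- The factor of `t a * star (t b) * exp(-½ |t|²)` that depends on the coordinate `i`. -/
def momentFactor (a b i : Fin d) (z : ℂ) : ℂ :=
  ((if i = a then z else 1) * if i = b then star z else 1) * Real.exp (-(1 / 2) * ‖z‖ ^ 2)

theorem integrable_momentFactor (a b i : Fin d) : Integrable (momentFactor a b i) := by
  have h : ∀ {f : ℂ → ℂ}, Continuous f → ∀ {g : ℂ → ℝ},
      Integrable (fun z : ℂ => g z * Real.exp (-(1 / 2) * ‖z‖ ^ 2)) → (∀ z, ‖f z‖ ≤ g z) →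
      Integrable fun z => f z * Real.exp (-(1 / 2) * ‖z‖ ^ 2) := by
    intro f hf g hg hle
    refine hg.mono' (Continuous.aestronglyMeasurable (by fun_prop))
      (Eventually.of_forall fun z => ?_)
    rw [norm_mul, Complex.norm_real, Real.norm_of_nonneg (Real.exp_pos _).le]
    exact mul_le_mul_of_nonneg_right (hle z) (Real.exp_pos _).le
  unfold momentFactor
  split_ifs with ha hb hb
  · exact h (by fun_prop) integrable_norm_sq_mul_exp fun z => by simp [sq]
  · exact h (by fun_prop) integrable_norm_mul_exp fun z => by simp
  · exact h (by fun_prop) integrable_norm_mul_exp fun z => by simp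
  · exact h (by fun_prop) (g := fun _ => 1) (by simpa using integrable_exp_neg_half_norm_sq)
      fun z => by simp

theorem gaussWeight_one (t : Fin d → ℂ) :
    (gaussWeight 1 t : ℂ) = ∏ i, (Real.exp (-(1 / 2) * ‖t i‖ ^ 2) : ℂ) := by
  rw [gaussWeight, ← Complex.ofReal_prod, ← Real.exp_sum, Matrix.one_mulVec, ← Finset.mul_sum]
  congr 3
  simp only [dotProduct, Complex.re_sum, Pi.star_apply]
  refine Finset.sum_congr rfl fun i _ => ?_
  rw [← Complex.normSq_eq_norm_sq, Complex.star_def, ← Complex.normSq_eq_conj_mul_self,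
    Complex.ofReal_re]

theorem prod_momentFactor (a b : Fin d) (t : Fin d → ℂ) :
    ∏ i, momentFactor a b i (t i) = t a * star (t b) * gaussWeight 1 t := by
  simp only [momentFactor, Finset.prod_mul_distrib, gaussWeight_one, Finset.prod_ite_eq',
    Finset.mem_univ, if_true]

theorem integrable_mul_star_mul_gaussWeight_one (a b : Fin d) :
    Integrable fun t : Fin d → ℂ => t a * star (t b) * gaussWeight 1 t := by
  simp only [← prod_momentFactor]
  exact Integrable.fintype_prod_dep fun i => integrable_momentFactor a b i

theorem integrable_gaussWeight_one : Integrable (gaussWeight (1 : Matrix (Fin d) (Fin d) ℂ)) := by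
  have h : Integrable fun t : Fin d → ℂ => (gaussWeight 1 t : ℂ) := by
    simp only [gaussWeight_one]
    exact Integrable.fintype_prod_dep (f := fun (_ : Fin d) (z : ℂ) =>
      (Real.exp (-(1 / 2) * ‖z‖ ^ 2) : ℂ)) fun i => integrable_exp_neg_half_norm_sq.ofReal
  simpa using h.re

/-- The integral factors over coordinates. On the diagonal, coordinate `a` contributes $4\pi$ in
place of $2\pi$: this is the origin of the factor $2$ that the $\tfrac12$ in `condCov` compensates.
-/
theorem integral_mul_star_mul_gaussWeight_one (a b : Fin d) :
    ∫ t : Fin d → ℂ, t a * star (t b) * gaussWeight 1 t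
      = if a = b then 2 * ((∫ t : Fin d → ℂ, gaussWeight 1 t : ℝ) : ℂ) else 0 := by
  simp only [← prod_momentFactor]
  rw [integral_fintype_prod_volume_eq_prod]
  split_ifs with hab
  · subst hab
    have h1 : ∀ i, ∫ z, momentFactor a a i z
        = (if i = a then 2 else 1) * ((∫ z : ℂ, Real.exp (-(1 / 2) * ‖z‖ ^ 2) : ℝ) : ℂ) := by
      intro i
      unfold momentFactor
      split_ifs with hi
      · have : ∀ z : ℂ, z * star z * (Real.exp (-(1 / 2) * ‖z‖ ^ 2) : ℂ)
            = ((‖z‖ ^ 2 * Real.exp (-(1 / 2) * ‖z‖ ^ 2) : ℝ) : ℂ) := by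
          intro z
          rw [Complex.star_def, Complex.mul_conj, Complex.normSq_eq_norm_sq]
          push_cast
          ring
        simp only [this]
        rw [integral_complex_ofReal, integral_norm_sq_mul_exp, integral_exp_neg_half_norm_sq]
        push_cast
        ring
      · simp only [one_mul]
        rw [integral_complex_ofReal]
    simp only [h1]
    simp only [Finset.prod_mul_distrib, ← integral_complex_ofReal, gaussWeight_one]
    rw [integral_fintype_prod_volume_eq_prod (𝕜 := ℂ) (fun (_ : Fin d) (z : ℂ) =>
      (Real.exp (-(1 / 2) * ‖z‖ ^ 2) : ℂ))]
    simp
  · refine Finset.prod_eq_zero (Finset.mem_univ a) ?_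
    -- Off the diagonal the factor of coordinate `a` is odd.
    have h : ∀ z, momentFactor a b a (-z) = -momentFactor a b a z := by
      intro z
      simp [momentFactor, hab]
    have h2 := integral_neg_eq_self (momentFactor a b a) (volume : Measure ℂ)
    simp only [h, integral_neg] at h2
    exact self_eq_neg.1 h2.symm

theorem integral_gaussMeasure {E : Type*} [NormedAddCommGroup E] [NormedSpace ℝ E]
    (K : Matrix (Fin d) (Fin d) ℂ) (f : (Fin d → ℂ) → E) :
    ∫ y, f y ∂(gaussMeasure K) = ∫ y, gaussWeight K y • f y := by
  rw [gaussMeasure, integral_withDensity_eq_integral_toReal_smul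
    (continuous_gaussWeight K).measurable.ennreal_ofReal
    (Eventually.of_forall fun _ => ENNReal.ofReal_lt_top)]
  simp only [ENNReal.toReal_ofReal (gaussWeight_nonneg K _)]

theorem integrable_gaussMeasure_iff {E : Type*} [NormedAddCommGroup E] [NormedSpace ℝ E]
    (K : Matrix (Fin d) (Fin d) ℂ) (f : (Fin d → ℂ) → E) :
    Integrable f (gaussMeasure K) ↔ Integrable fun y => gaussWeight K y • f y := by
  rw [gaussMeasure, integrable_withDensity_iff_integrable_smul'
    (continuous_gaussWeight K).measurable.ennreal_ofReal
    (Eventually.of_forall fun _ => ENNReal.ofReal_lt_top)]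
  simp only [ENNReal.toReal_ofReal (gaussWeight_nonneg K _)]

theorem isFiniteMeasure_gaussMeasure_one :
    IsFiniteMeasure (gaussMeasure (1 : Matrix (Fin d) (Fin d) ℂ)) :=
  isFiniteMeasure_withDensity_ofReal integrable_gaussWeight_one.2

theorem memLp_gaussMeasure_one :
    MemLp (fun t : Fin d → ℂ => t) 2 (gaussMeasure (1 : Matrix (Fin d) (Fin d) ℂ)) := by
  refine memLp_pi_iff.2 fun a => ?_
  rw [memLp_two_iff_integrable_sq_norm (Continuous.aestronglyMeasurable (by fun_prop)),
    integrable_gaussMeasure_iff]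
  refine ((integrable_mul_star_mul_gaussWeight_one a a).norm).congr
    (Eventually.of_forall fun t => ?_)
  beta_reduce
  rw [norm_mul, norm_mul, norm_star, ← sq, Complex.norm_real, smul_eq_mul, mul_comm,
    Real.norm_of_nonneg (gaussWeight_nonneg 1 t)]

theorem integral_gaussMeasure_one_mul_star (a b : Fin d) :
    ∫ t, t a * star (t b) ∂(gaussMeasure (1 : Matrix (Fin d) (Fin d) ℂ))
      = 2 * ((gaussMeasure (1 : Matrix (Fin d) (Fin d) ℂ)).real Set.univ : ℂ)
        * (1 : Matrix (Fin d) (Fin d) ℂ) a b := by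
  have h1 : (gaussMeasure (1 : Matrix (Fin d) (Fin d) ℂ)).real Set.univ
      = ∫ t : Fin d → ℂ, gaussWeight 1 t := by
    have := integral_gaussMeasure (1 : Matrix (Fin d) (Fin d) ℂ) fun _ => (1 : ℝ)
    simpa using this
  rw [integral_gaussMeasure, h1]
  have h2 := integral_mul_star_mul_gaussWeight_one a b
  simp only [Complex.real_smul, mul_comm ((gaussWeight 1 _ : ℝ) : ℂ)]
  rw [h2, Matrix.one_apply]
  split_ifs <;> simp

open scoped MatrixOrder Matrix.Norms.L2Operator in
theorem exists_eq_conjTranspose_mul_self {K : Matrix (Fin d) (Fin d) ℂ} (hK : K.PosSemidef) :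
    ∃ S : Matrix (Fin d) (Fin d) ℂ, K = Sᴴ * S :=
  CStarAlgebra.nonneg_iff_eq_star_mul_self.mp hK.nonneg

theorem map_withDensity_comp {α β : Type*} [MeasurableSpace α] [MeasurableSpace β]
    (μ : Measure α) {f : α → β} (hf : Measurable f) {g : β → ENNReal} (hg : Measurable g) :
    Measure.map f (μ.withDensity fun x => g (f x)) = (Measure.map f μ).withDensity g := by
  ext s hs
  rw [Measure.map_apply hf hs, withDensity_apply _ (hf hs), withDensity_apply _ hs,
    setLIntegral_map hs hg hf]

/-- With $K=S^*S$ the map $y\mapsto Sy$ turns the weight of `K` into the standard one; Lebesgue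
measure is only rescaled, by a finite constant whose value is irrelevant. -/
theorem exists_map_gaussMeasure {K : Matrix (Fin d) (Fin d) ℂ} (hK : K.PosDef) :
    ∃ S : Matrix (Fin d) (Fin d) ℂ, IsUnit S.det ∧ K = Sᴴ * S ∧ ∃ c : ENNReal, c ≠ ⊤ ∧
      Measure.map (fun y => S *ᵥ y) (gaussMeasure K) = c • gaussMeasure 1 := by
  obtain ⟨S, hS⟩ := exists_eq_conjTranspose_mul_self hK.posSemidef
  have hdet : IsUnit S.det := by
    have := isUnit_det_of_posDef hK
    rw [hS, Matrix.det_mul] at this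
    exact isUnit_of_mul_isUnit_right this
  -- Lebesgue measure scales by the real determinant of `S`; its nonvanishing is read off from the
  -- inverse map, without relating it to the complex determinant.
  let f : (Fin d → ℂ) →ₗ[ℝ] (Fin d → ℂ) := S.mulVecLin.restrictScalars ℝ
  let g : (Fin d → ℂ) →ₗ[ℝ] (Fin d → ℂ) := (S⁻¹).mulVecLin.restrictScalars ℝ
  have hfg : f * g = 1 := by
    refine LinearMap.ext fun x => ?_
    change S *ᵥ (S⁻¹ *ᵥ x) = x
    rw [Matrix.mulVec_mulVec, Matrix.mul_nonsing_inv _ hdet, Matrix.one_mulVec]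
  have hf : LinearMap.det f ≠ 0 := by
    intro h0
    have := congrArg LinearMap.det hfg
    rw [map_mul, h0, map_one, zero_mul] at this
    exact zero_ne_one this
  refine ⟨S, hdet, hS, ENNReal.ofReal |(LinearMap.det f)⁻¹|, ENNReal.ofReal_ne_top, ?_⟩
  have hmap := Measure.map_linearMap_addHaar_eq_smul_addHaar (volume : Measure (Fin d → ℂ)) hf
  have hw : ∀ y, gaussWeight K y = gaussWeight 1 (S *ᵥ y) := by
    intro y
    rw [gaussWeight, gaussWeight, Matrix.one_mulVec, Matrix.star_mulVec, hS,
      ← Matrix.mulVec_mulVec, Matrix.dotProduct_mulVec, Matrix.dotProduct_mulVec]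
  have hm : Measurable fun y : Fin d → ℂ => S *ᵥ y := Continuous.measurable (by fun_prop)
  have hcoe : (f : (Fin d → ℂ) → Fin d → ℂ) = fun y => S *ᵥ y := rfl
  rw [hcoe] at hmap
  rw [gaussMeasure, gaussMeasure, ← withDensity_smul_measure, ← hmap,
    ← map_withDensity_comp _ hm (continuous_gaussWeight 1).measurable.ennreal_ofReal]
  simp only [hw]

/-- Pull the standard moments back through $S^{-1}$ and use $(S^*S)^{-1}=S^{-1}S^{-*}$. The total
mass stays as a factor, so no normalization is computed. -/
theorem gaussMeasure_moments {K : Matrix (Fin d) (Fin d) ℂ} (hK : K.PosDef) :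
    IsFiniteMeasure (gaussMeasure K) ∧ MemLp (fun y : Fin d → ℂ => y) 2 (gaussMeasure K) ∧
      ∀ i j, ∫ y, y i * star (y j) ∂(gaussMeasure K)
        = 2 * ((gaussMeasure K).real Set.univ : ℂ) * K⁻¹ i j := by
  obtain ⟨S, hdet, hS, c, hc, hmap⟩ := exists_map_gaussMeasure hK
  have hm : Measurable fun y : Fin d → ℂ => S *ᵥ y := Continuous.measurable (by fun_prop)
  have hinv : ∀ y, S⁻¹ *ᵥ (S *ᵥ y) = y := fun y => by
    rw [Matrix.mulVec_mulVec, Matrix.nonsing_inv_mul _ hdet, Matrix.one_mulVec]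
  have huniv : gaussMeasure K Set.univ
      = c * gaussMeasure (1 : Matrix (Fin d) (Fin d) ℂ) Set.univ := by
    rw [← smul_eq_mul, ← Measure.smul_apply, ← hmap, Measure.map_apply hm MeasurableSet.univ,
      Set.preimage_univ]
  have := isFiniteMeasure_gaussMeasure_one (d := d)
  have hfin : IsFiniteMeasure (gaussMeasure K) :=
    ⟨by rw [huniv]; exact ENNReal.mul_lt_top hc.lt_top (measure_lt_top _ _)⟩
  refine ⟨hfin, ?_, fun i j => ?_⟩
  · have h1 : MemLp (fun t : Fin d → ℂ => S⁻¹ *ᵥ t) 2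
        (Measure.map (fun y => S *ᵥ y) (gaussMeasure K)) := by
      rw [hmap]
      exact ((S⁻¹).mulVecLin.restrictScalars ℝ).toContinuousLinearMap.comp_memLp'
        (memLp_gaussMeasure_one.smul_measure hc)
    have h2 := h1.comp_of_map hm.aemeasurable
    simpa only [Function.comp_def, hinv] using h2
  · have h1 : ∫ y, y i * star (y j) ∂(gaussMeasure K)
        = ∫ t, (S⁻¹ *ᵥ t) i * star ((S⁻¹ *ᵥ t) j)
          ∂(Measure.map (fun y => S *ᵥ y) (gaussMeasure K)) := by
      rw [integral_map hm.aemeasurable (Continuous.aestronglyMeasurable (by fun_prop))]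
      simp only [hinv]
    have h2 : ∀ t : Fin d → ℂ, (S⁻¹ *ᵥ t) i * star ((S⁻¹ *ᵥ t) j)
        = ∑ a, ∑ b, S⁻¹ i a * star (S⁻¹ j b) * (t a * star (t b)) := by
      intro t
      simp only [Matrix.mulVec, dotProduct, star_sum, Finset.sum_mul_sum, star_mul']
      exact Finset.sum_congr rfl fun a _ => Finset.sum_congr rfl fun b _ => by ring
    have hint : ∀ a b, Integrable (fun t : Fin d → ℂ => t a * star (t b))
        (gaussMeasure (1 : Matrix (Fin d) (Fin d) ℂ)) := by
      intro a b
      rw [integrable_gaussMeasure_iff]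
      simpa [mul_comm] using integrable_mul_star_mul_gaussWeight_one a b
    have hreal : (gaussMeasure K).real Set.univ
        = c.toReal * (gaussMeasure (1 : Matrix (Fin d) (Fin d) ℂ)).real Set.univ := by
      rw [measureReal_def, huniv, ENNReal.toReal_mul, measureReal_def]
    rw [h1, hmap, integral_smul_measure, hreal, hS, Matrix.mul_inv_rev,
      ← Matrix.conjTranspose_nonsing_inv]
    simp only [h2]
    rw [integral_finsetSum _ fun a _ => integrable_finsetSum _ fun b _ => (hint a b).const_mul _]
    simp only [integral_finsetSum _ fun b _ => (hint _ b).const_mul _, integral_const_mul,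
      integral_gaussMeasure_one_mul_star, Matrix.mul_apply, Matrix.conjTranspose_apply,
      Matrix.one_apply, mul_ite, mul_one, mul_zero, Finset.sum_ite_eq, Finset.mem_univ, if_true,
      Complex.real_smul, Finset.mul_sum]
    push_cast
    exact Finset.sum_congr rfl fun a _ => by ring

theorem integral_gaussMeasure_eq_zero (K : Matrix (Fin d) (Fin d) ℂ) :
    ∫ y, y ∂(gaussMeasure K) = 0 := by
  rw [integral_gaussMeasure]
  have h := integral_neg_eq_self (fun y : Fin d → ℂ => gaussWeight K y • y) volume
  have hw : ∀ y, gaussWeight K (-y) = gaussWeight K y := by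
    intro y
    simp [gaussWeight, Matrix.mulVec_neg]
  simp only [hw, smul_neg, integral_neg] at h
  exact self_eq_neg.1 h.symm

end GaussMarkov
end

/-! ### Factorization of the chain density and independence of the innovations. -/

noncomputable section

open Filter Topology Matrix ProbabilityTheory

namespace GaussMarkov

variable {d : ℕ} {A : BlockMatrix d} {W : Matrix (Fin d) (Fin d) ℂ}

/-- Completing the square in $y$: the quadratic coefficient is $A_{RR}+B_R=K$, the minimizer is $Wx$
because $KW=-A_{RL}$, and the remainder in $x$ is again $B_R$. -/
theorem energy_add_boundary (hA : A.PosDef) (hW : IsStableSolvent A W) (x y : Fin d → ℂ) :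
    energy A x y + star y ⬝ᵥ (rightBoundary A W *ᵥ y)
      = star x ⬝ᵥ (rightBoundary A W *ᵥ x)
        + star (y - W *ᵥ x) ⬝ᵥ (innovationPrecision A W *ᵥ (y - W *ᵥ x)) := by
  have h1 : innovationPrecision A W *ᵥ (y - W *ᵥ x)
      = innovationPrecision A W *ᵥ y + blkRL A *ᵥ x := by
    rw [Matrix.mulVec_sub, Matrix.mulVec_mulVec, innovationPrecision_mul hW, Matrix.neg_mulVec,
      sub_neg_eq_add]
  have h2 : ∀ v, star (y - W *ᵥ x) ⬝ᵥ v = star y ⬝ᵥ v - star x ⬝ᵥ (Wᴴ *ᵥ v) := by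
    intro v
    rw [star_sub, sub_dotProduct, Matrix.star_mulVec, ← Matrix.dotProduct_mulVec]
  rw [h1, h2, Matrix.mulVec_add Wᴴ, Matrix.mulVec_mulVec, Matrix.mulVec_mulVec,
    conjTranspose_mul_innovationPrecision hA hW, ← blkLR_mul_eq hA hW, energy_eq,
    innovationPrecision]
  simp only [rightBoundary, Matrix.add_mulVec, dotProduct_add, Matrix.neg_mulVec, dotProduct_neg,
    ← Matrix.mulVec_mulVec]
  ring

theorem edgeWeight_mul_boundaryWeight (hA : A.PosDef) (hW : IsStableSolvent A W) (α β : ℝ)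
    (x y : Fin d → ℂ) :
    edgeWeight α A x y * boundaryWeight β (rightBoundary A W) y
      = α * boundaryWeight β (rightBoundary A W) x
        * gaussWeight (innovationPrecision A W) (y - W *ᵥ x) := by
  have h := congrArg Complex.re (energy_add_boundary hA hW x y)
  rw [Complex.add_re, Complex.add_re, energy] at h
  have e : ∀ a b c e : ℝ, a + b = c + e → Real.exp (-(1 / 2) * a) * Real.exp (-(1 / 2) * b)
      = Real.exp (-(1 / 2) * c) * Real.exp (-(1 / 2) * e) := by
    intro a b c e h
    rw [← Real.exp_add, ← Real.exp_add, ← mul_add, ← mul_add, h]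
  have h' := e _ _ _ _ h
  unfold edgeWeight boundaryWeight gaussWeight
  linear_combination (α * β) * h'

/-- The last innovation of a window, together with the rest of the window. -/
def splitLast (W : Matrix (Fin d) (Fin d) ℂ) (P : ℕ) (x : Fin (P + 2) → Fin d → ℂ) :
    (Fin (P + 1) → Fin d → ℂ) × (Fin d → ℂ) :=
  (fun k => x k.castSucc, x (Fin.last (P + 1)) - W *ᵥ x (Fin.last P).castSucc)

theorem chainWeight_succ (hA : A.PosDef) (hW : IsStableSolvent A W) (α βL βR : ℝ)
    (BL : Matrix (Fin d) (Fin d) ℂ) (P : ℕ) (x : Fin (P + 2) → Fin d → ℂ) :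
    chainWeight α A βL BL βR (rightBoundary A W) (P + 1) x
      = α * chainWeight α A βL BL βR (rightBoundary A W) P (splitLast W P x).1
        * gaussWeight (innovationPrecision A W) (splitLast W P x).2 := by
  have h := edgeWeight_mul_boundaryWeight hA hW α βR (x (Fin.last P).castSucc)
    (x (Fin.last (P + 1)))
  unfold chainWeight splitLast
  rw [Fin.prod_univ_castSucc, mul_assoc, mul_assoc, Fin.succ_last, h]
  simp only [Fin.castSucc_zero, Fin.succ_castSucc]
  ring

/-- A shear: with the earlier sites fixed, the last one is merely translated. -/
theorem measurePreserving_splitLast (W : Matrix (Fin d) (Fin d) ℂ) (P : ℕ) :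
    MeasurePreserving (splitLast W P) volume (volume.prod volume) := by
  have h1 := volume_preserving_piFinSuccAbove (fun _ : Fin (P + 2) => Fin d → ℂ)
    (Fin.last (P + 1))
  have h2 : MeasurePreserving (Prod.swap :
      (Fin d → ℂ) × (Fin (P + 1) → Fin d → ℂ) → (Fin (P + 1) → Fin d → ℂ) × (Fin d → ℂ))
      (volume.prod volume) (volume.prod volume) := Measure.measurePreserving_swap
  have h3 : MeasurePreserving (fun p : (Fin (P + 1) → Fin d → ℂ) × (Fin d → ℂ) =>
      (id p.1, (fun x y => y - W *ᵥ x (Fin.last P)) p.1 p.2))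
      (volume.prod volume) (volume.prod volume) := by
    refine (MeasurePreserving.id (volume : Measure (Fin (P + 1) → Fin d → ℂ))).skew_product
      (g := fun x y => y - W *ᵥ x (Fin.last P)) ?_ (Eventually.of_forall fun x => ?_)
    · refine Continuous.measurable ?_
      unfold Function.uncurry
      fun_prop
    · exact map_sub_right_eq_self _ _
  convert! h3.comp (h2.comp h1) using 1
  ext x i
  · simp [splitLast, MeasurableEquiv.piFinSuccAbove, Fin.insertNthEquiv, Fin.init]
  · simp [splitLast, MeasurableEquiv.piFinSuccAbove, Fin.insertNthEquiv, Fin.init]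

theorem continuous_chainWeight (α βL βR : ℝ) (A : BlockMatrix d)
    (BL BR : Matrix (Fin d) (Fin d) ℂ) (P : ℕ) :
    Continuous (chainWeight α A βL BL βR BR P) := by
  have h : ∀ k : Fin P, Continuous fun x : Fin (P + 1) → Fin d → ℂ =>
      edgeWeight α A (x k.castSucc) (x k.succ) := by
    intro k
    have : ∀ x y, edgeWeight α A x y = α * Real.exp (-(1 / 2) * (energy A x y).re) :=
      fun _ _ => rfl
    simp only [this, energy_eq]
    fun_prop
  unfold chainWeight boundaryWeight
  fun_prop

/-- The windows of the process `X` have a density proportional to the chain weight. -/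
structure HasChainDensity {Ω : Type*} [MeasurableSpace Ω] (μ : Measure Ω)
    (α : ℝ) (A : BlockMatrix d) (βL : ℝ) (BL : Matrix (Fin d) (Fin d) ℂ)
    (βR : ℝ) (BR : Matrix (Fin d) (Fin d) ℂ) (X : ℤ → Ω → Fin d → ℂ) : Prop where
  measurable : ∀ k, Measurable (X k)
  law : ∀ (a : ℤ) (P : ℕ), 0 < P → ∃ C : ℝ,
    μ.map (fun ω (k : Fin (P + 1)) => X (a + (k : ℕ)) ω)
      = volume.withDensity fun x => ENNReal.ofReal (C * chainWeight α A βL BL βR BR P x)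

/-- Only the shape of the density is used later. Leaving the constant free avoids computing
partition functions or comparing them under reversal. -/
theorem IsGibbsProcess.hasChainDensity {Ω : Type*} [MeasurableSpace Ω] {μ : Measure Ω}
    {α βL βR : ℝ} {BL BR : Matrix (Fin d) (Fin d) ℂ} {X : ℤ → Ω → Fin d → ℂ}
    (h : IsGibbsProcess μ α A βL BL βR BR X) : HasChainDensity μ α A βL BL βR BR X :=
  ⟨h.measurable, fun a P hP => ⟨_, h.law a P hP⟩⟩

theorem edgeWeight_swapBlocks (α : ℝ) (A : BlockMatrix d) (x y : Fin d → ℂ) :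
    edgeWeight α (swapBlocks A) x y = edgeWeight α A y x := by
  have h : energy (swapBlocks A) x y = energy A y x := by
    rw [energy_eq, energy_eq]
    have h1 : blkLL (swapBlocks A) = blkRR A := rfl
    have h2 : blkRR (swapBlocks A) = blkLL A := rfl
    have h3 : blkLR (swapBlocks A) = blkRL A := rfl
    have h4 : blkRL (swapBlocks A) = blkLR A := rfl
    rw [h1, h2, h3, h4, add_comm (blkRR A *ᵥ x), add_comm (blkLR A *ᵥ x), add_comm]
  exact congrArg (fun z : ℂ => α * Real.exp (-(1 / 2) * z.re)) h

theorem chainWeight_rev (α βL βR : ℝ) (A : BlockMatrix d)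
    (BL BR : Matrix (Fin d) (Fin d) ℂ) (P : ℕ) (x : Fin (P + 1) → Fin d → ℂ) :
    chainWeight α (swapBlocks A) βR BR βL BL P (fun k => x k.rev)
      = chainWeight α A βL BL βR BR P x := by
  unfold chainWeight
  rw [← Equiv.prod_comp Fin.revPerm]
  simp only [edgeWeight_swapBlocks, Fin.revPerm_apply, Fin.rev_zero, Fin.rev_last,
    ← Fin.rev_succ, ← Fin.rev_castSucc, Fin.rev_rev]
  ring

theorem measurePreserving_rev (P : ℕ) :
    MeasurePreserving (fun (x : Fin (P + 1) → Fin d → ℂ) (k : Fin (P + 1)) => x k.rev)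
      volume volume := by
  convert! volume_measurePreserving_piCongrLeft (fun _ : Fin (P + 1) => Fin d → ℂ) Fin.revPerm
    using 1
  ext1 x
  ext1 k
  obtain ⟨m, rfl⟩ := Fin.revPerm.surjective k
  rw [MeasurableEquiv.coe_piCongrLeft, Equiv.piCongrLeft_apply_apply, Fin.revPerm_apply,
    Fin.rev_rev]

/-- Reversing a window exchanges the blocks and the two boundaries, so predictions of the past
become predictions of the future for the reversed process. -/
theorem HasChainDensity.reverse {Ω : Type*} [MeasurableSpace Ω] {μ : Measure Ω}
    {α βL βR : ℝ} {BL BR : Matrix (Fin d) (Fin d) ℂ} {X : ℤ → Ω → Fin d → ℂ}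
    (h : HasChainDensity μ α A βL BL βR BR X) :
    HasChainDensity μ α (swapBlocks A) βR BR βL BL fun k => X (-k) := by
  refine ⟨fun k => h.measurable _, fun a P hP => ?_⟩
  obtain ⟨C, hC⟩ := h.law (-(a + P)) P hP
  refine ⟨C, ?_⟩
  have hmeas : Measurable fun ω (k : Fin (P + 1)) => X (-(a + P) + (k : ℕ)) ω :=
    measurable_pi_lambda _ fun k => h.measurable _
  have h1 : (fun ω (k : Fin (P + 1)) => X (-(a + (k : ℕ))) ω)
      = (fun (x : Fin (P + 1) → Fin d → ℂ) k => x k.rev)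
        ∘ fun ω (k : Fin (P + 1)) => X (-(a + P) + (k : ℕ)) ω := by
    ext1 ω
    ext1 k
    simp only [Function.comp_apply]
    have h2 : ((k.rev : ℕ) : ℤ) = P - (k : ℕ) := by
      have := k.2
      rw [Fin.val_rev]
      omega
    rw [h2]
    congr 2
    ring
  have hrev := measurePreserving_rev (d := d) P
  rw [h1, ← Measure.map_map hrev.measurable hmeas, hC]
  simp only [← chainWeight_rev α βL βR A BL BR P]
  rw [map_withDensity_comp _ hrev.measurable (g := fun x => ENNReal.ofReal
    (C * chainWeight α (swapBlocks A) βR BR βL BL P x)), hrev.map_eq]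
  exact ((continuous_chainWeight _ _ _ _ _ _ _).const_mul C).measurable.ennreal_ofReal

/-- The factors need not be probability measures: each marginal is its factor times the other's
mass, and the product of the two masses is $1$. -/
theorem indepFun_of_map_prod {Ω E F : Type*} [MeasurableSpace Ω] [MeasurableSpace E]
    [MeasurableSpace F] {μ : Measure Ω} [IsProbabilityMeasure μ] {U : Ω → E} {V : Ω → F}
    (hU : Measurable U) (hV : Measurable V) {ρ : Measure E} {γ : Measure F} [SFinite ρ]
    [SFinite γ] (h : μ.map (fun ω => (U ω, V ω)) = ρ.prod γ) :
    IndepFun U V μ ∧ (∃ c : ENNReal, μ.map U = c • ρ) ∧ ∃ c : ENNReal, μ.map V = c • γ := by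
  have h1 : μ.map U = γ Set.univ • ρ := by
    rw [← Measure.map_fst_prod, ← h, Measure.map_map measurable_fst (hU.prodMk hV)]
    rfl
  have h2 : μ.map V = ρ Set.univ • γ := by
    rw [← Measure.map_snd_prod, ← h, Measure.map_map measurable_snd (hU.prodMk hV)]
    rfl
  have h3 : γ Set.univ * ρ Set.univ = 1 := by
    have := congrArg (fun ν => ν Set.univ) h1
    rw [Measure.map_apply hU MeasurableSet.univ] at this
    simpa using this.symm
  refine ⟨?_, ⟨_, h1⟩, ⟨_, h2⟩⟩
  rw [indepFun_iff_map_prod_eq_prod_map_map hU.aemeasurable hV.aemeasurable, h, h1, h2,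
    Measure.prod_smul_left, Measure.prod_smul_right, smul_smul, h3, one_smul]

section Law

variable {Ω : Type*} [MeasurableSpace Ω] {μ : Measure Ω} [IsProbabilityMeasure μ]
  {α βL βR : ℝ} {BL : Matrix (Fin d) (Fin d) ℂ} {X : ℤ → Ω → Fin d → ℂ}

/-- In the coordinates of `splitLast` the density of a window with one more site is a product of a
function of the shorter window and a Gaussian weight of the innovation. -/
theorem HasChainDensity.indepFun_innovation (hA : A.PosDef) (hW : IsStableSolvent A W)
    (h : HasChainDensity μ α A βL BL βR (rightBoundary A W) X) (a : ℤ) (P : ℕ) :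
    IndepFun (fun ω (k : Fin (P + 1)) => X (a + (k : ℕ)) ω)
        (fun ω => X (a + P + 1) ω - W *ᵥ X (a + P) ω) μ ∧
      (∃ C : ℝ, ∃ c : ENNReal, μ.map (fun ω (k : Fin (P + 1)) => X (a + (k : ℕ)) ω)
        = c • volume.withDensity fun x =>
          ENNReal.ofReal (C * chainWeight α A βL BL βR (rightBoundary A W) P x)) ∧
      ∃ c : ENNReal, μ.map (fun ω => X (a + P + 1) ω - W *ᵥ X (a + P) ω)
        = c • gaussMeasure (innovationPrecision A W) := by
  obtain ⟨C, hC⟩ := h.law a (P + 1) P.succ_pos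
  have hU : Measurable fun ω (k : Fin (P + 1)) => X (a + (k : ℕ)) ω :=
    measurable_pi_lambda _ fun k => h.measurable _
  have hV : Measurable fun ω => X (a + P + 1) ω - W *ᵥ X (a + P) ω := by
    have hc : Measurable fun x : Fin d → ℂ => W *ᵥ x := Continuous.measurable (by fun_prop)
    exact (h.measurable _).sub (hc.comp (h.measurable _))
  have hZ : Measurable fun ω (k : Fin (P + 1 + 1)) => X (a + (k : ℕ)) ω :=
    measurable_pi_lambda _ fun k => h.measurable _
  have hsplit : (fun ω => ((fun k : Fin (P + 1) => X (a + (k : ℕ)) ω),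
        X (a + P + 1) ω - W *ᵥ X (a + P) ω))
      = splitLast W P ∘ fun ω (k : Fin (P + 1 + 1)) => X (a + (k : ℕ)) ω := by
    ext1 ω
    simp [splitLast, add_assoc]
  have hmp := measurePreserving_splitLast W P
  have hcw := ((continuous_chainWeight α βL βR A BL (rightBoundary A W) P).const_mul
    (C * α)).measurable.ennreal_ofReal
  have hgw := (continuous_gaussWeight (innovationPrecision A W)).measurable.ennreal_ofReal
  have hprod : μ.map (fun ω => ((fun k : Fin (P + 1) => X (a + (k : ℕ)) ω),
        X (a + P + 1) ω - W *ᵥ X (a + P) ω))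
      = (volume.withDensity fun x => ENNReal.ofReal
          (C * α * chainWeight α A βL BL βR (rightBoundary A W) P x)).prod
        (gaussMeasure (innovationPrecision A W)) := by
    rw [hsplit, ← Measure.map_map hmp.measurable hZ, hC, gaussMeasure, prod_withDensity hcw hgw,
      ← hmp.map_eq, ← map_withDensity_comp _ hmp.measurable
        (g := fun z => ENNReal.ofReal
          (C * α * chainWeight α A βL BL βR (rightBoundary A W) P z.1)
          * ENNReal.ofReal (gaussWeight (innovationPrecision A W) z.2))
        ((hcw.comp measurable_fst).mul (hgw.comp measurable_snd))]
    congr 2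
    ext1 x
    rw [← ENNReal.ofReal_mul' (gaussWeight_nonneg _ _), chainWeight_succ hA hW]
    congr 1
    ring
  have : SFinite (gaussMeasure (innovationPrecision A W)) := by
    unfold gaussMeasure; infer_instance
  obtain ⟨h1, ⟨c, h2⟩, h3⟩ := indepFun_of_map_prod hU hV hprod
  exact ⟨h1, ⟨_, c, h2⟩, h3⟩

theorem moments_of_map_eq_smul_gaussMeasure {K : Matrix (Fin d) (Fin d) ℂ} (hK : K.PosDef)
    {Y : Ω → Fin d → ℂ} (hY : Measurable Y) {c : ENNReal}
    (h : μ.map Y = c • gaussMeasure K) :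
    MemLp Y 2 μ ∧ ∫ ω, Y ω ∂μ = 0 ∧
      ∀ i j, ∫ ω, Y ω i * star (Y ω j) ∂μ = 2 * K⁻¹ i j := by
  obtain ⟨h1, h2, h3⟩ := gaussMeasure_moments hK
  have hone : c * gaussMeasure K Set.univ = 1 := by
    have := congrArg (fun ν => ν Set.univ) h
    rw [Measure.map_apply hY MeasurableSet.univ] at this
    simpa using this.symm
  have hc : c ≠ ⊤ := by
    rintro rfl
    rw [ENNReal.top_mul (right_ne_zero_of_mul_eq_one hone)] at hone
    exact ENNReal.top_ne_one hone
  refine ⟨?_, ?_, fun i j => ?_⟩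
  · have : MemLp (fun y : Fin d → ℂ => y) 2 (μ.map Y) := by
      rw [h]
      exact h2.smul_measure hc
    exact this.comp_of_map hY.aemeasurable
  · rw [← integral_map hY.aemeasurable (f := fun y => y) aestronglyMeasurable_id, h,
      integral_smul_measure, integral_gaussMeasure_eq_zero, smul_zero]
  · rw [← integral_map hY.aemeasurable (f := fun y => y i * star (y j))
      (Continuous.aestronglyMeasurable (by fun_prop)), h, integral_smul_measure, h3,
      Complex.real_smul]
    have : (c.toReal : ℂ) * ((gaussMeasure K).real Set.univ : ℂ) = 1 := by
      rw [← Complex.ofReal_mul, measureReal_def, ← ENNReal.toReal_mul, hone]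
      simp
    linear_combination (2 * K⁻¹ i j) * this

theorem HasChainDensity.memLp (hA : A.PosDef) (hW : IsStableSolvent A W)
    (hG : (BL + rightBoundary A W).PosDef)
    (h : HasChainDensity μ α A βL BL βR (rightBoundary A W) X) (a : ℤ) : MemLp (X a) 2 μ := by
  -- A one-site window is not covered by `law`; it is obtained as a marginal of a two-site window.
  -- Its weight is Gaussian with precision $B_L+B_R$.
  obtain ⟨-, ⟨C, c, hC⟩, -⟩ := h.indepFun_innovation hA hW a 0
  have hZ : Measurable fun ω (k : Fin (0 + 1)) => X (a + (k : ℕ)) ω :=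
    measurable_pi_lambda _ fun k => h.measurable _
  have hmp : MeasurePreserving (fun x : Fin (0 + 1) → Fin d → ℂ => x 0) volume volume :=
    volume_preserving_funUnique (Fin 1) (Fin d → ℂ)
  have hw : ∀ x : Fin (0 + 1) → Fin d → ℂ,
      chainWeight α A βL BL βR (rightBoundary A W) 0 x
        = βL * βR * gaussWeight (BL + rightBoundary A W) (x 0) := by
    intro x
    simp only [chainWeight, boundaryWeight, gaussWeight, Matrix.add_mulVec, dotProduct_add,
      Complex.add_re, mul_add, Real.exp_add, Finset.univ_eq_empty, Finset.prod_empty, mul_one]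
    have h1 : Fin.last 0 = 0 := rfl
    rw [h1]
    ring
  have hlaw : μ.map (X a) = (c * ENNReal.ofReal (C * (βL * βR)))
      • gaussMeasure (BL + rightBoundary A W) := by
    have h1 : X a = (fun x : Fin (0 + 1) → Fin d → ℂ => x 0)
        ∘ fun ω (k : Fin (0 + 1)) => X (a + (k : ℕ)) ω := by
      ext1 ω
      simp
    have h2 : ∀ x : Fin (0 + 1) → Fin d → ℂ, ENNReal.ofReal
        (C * chainWeight α A βL BL βR (rightBoundary A W) 0 x)
        = (fun y => ENNReal.ofReal (C * (βL * βR))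
          * ENNReal.ofReal (gaussWeight (BL + rightBoundary A W) y))
          (x 0) := by
      intro x
      beta_reduce
      rw [hw, ← ENNReal.ofReal_mul' (gaussWeight_nonneg _ _), ← mul_assoc]
    have hgw := (continuous_gaussWeight (BL + rightBoundary A W)).measurable.ennreal_ofReal
    rw [h1, ← Measure.map_map hmp.measurable hZ, hC, Measure.map_smul]
    simp only [h2]
    rw [map_withDensity_comp _ hmp.measurable (hgw.const_mul _), hmp.map_eq, mul_smul,
      gaussMeasure, ← withDensity_smul _ hgw]
    rfl
  exact (moments_of_map_eq_smul_gaussMeasure hG (h.measurable a) hlaw).1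

end Law

end GaussMarkov
end

/-! ### Conditional expectations and covariances of the autoregressive process. -/

noncomputable section

open Filter Topology Matrix ProbabilityTheory

namespace GaussMarkov

variable {d : ℕ} {A : BlockMatrix d} {W : Matrix (Fin d) (Fin d) ℂ}

/-- `f` is integrable and its conditional expectation is almost surely the constant `c`. -/
def HasConstCondExp {Ω : Type*} (m : MeasurableSpace Ω) [MeasurableSpace Ω] (μ : Measure Ω)
    (f : Ω → ℂ) (c : ℂ) : Prop :=
  Integrable f μ ∧ μ[f|m] =ᵐ[μ] fun _ => c

section HasConstCondExp

variable {Ω : Type*} {m : MeasurableSpace Ω} [MeasurableSpace Ω] {μ : Measure Ω}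
  {f g : Ω → ℂ} {a b : ℂ}

theorem HasConstCondExp.add (hf : HasConstCondExp m μ f a) (hg : HasConstCondExp m μ g b) :
    HasConstCondExp m μ (fun ω => f ω + g ω) (a + b) := by
  refine ⟨hf.1.add hg.1, (condExp_add hf.1 hg.1 m).trans ?_⟩
  filter_upwards [hf.2, hg.2] with ω h1 h2
  rw [Pi.add_apply, h1, h2]

theorem HasConstCondExp.const_mul (hf : HasConstCondExp m μ f a) (c : ℂ) :
    HasConstCondExp m μ (fun ω => c * f ω) (c * a) := by
  refine ⟨hf.1.const_mul c, (condExp_smul c f m).trans ?_⟩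
  filter_upwards [hf.2] with ω h1
  rw [Pi.smul_apply, h1, smul_eq_mul]

theorem HasConstCondExp.zero : HasConstCondExp m μ (fun _ => 0) 0 :=
  ⟨integrable_zero _ _ _, by
    have : μ[(fun _ => (0 : ℂ))|m] = 0 := condExp_zero
    rw [this]; rfl⟩

theorem HasConstCondExp.sum {ι : Type*} (s : Finset ι) {f : ι → Ω → ℂ} {a : ι → ℂ}
    (h : ∀ i, HasConstCondExp m μ (f i) (a i)) :
    HasConstCondExp m μ (fun ω => ∑ i ∈ s, f i ω) (∑ i ∈ s, a i) := by
  classical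
  induction s using Finset.induction_on with
  | empty => simpa using HasConstCondExp.zero
  | insert i s hi ih =>
    simp only [Finset.sum_insert hi]
    exact (h i).add ih

theorem HasConstCondExp.star (hf : HasConstCondExp m μ f a) :
    HasConstCondExp m μ (fun ω => star (f ω)) (star a) := by
  have h := (Complex.conjCLE : ℂ →L[ℝ] ℂ).comp_condExp_comm (m := m) hf.1
  refine ⟨(Complex.conjCLE : ℂ →L[ℝ] ℂ).integrable_comp hf.1, h.symm.trans ?_⟩
  filter_upwards [hf.2] with ω h1
  rw [Function.comp_apply, h1]
  rfl

end HasConstCondExp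

section Windows

variable {Ω : Type*}

/-- The innovation `X_{a+k+1} - W X_{a+k}`. -/
def innovation (W : Matrix (Fin d) (Fin d) ℂ) (X : ℤ → Ω → Fin d → ℂ) (a : ℤ) (k : ℕ) (ω : Ω) :
    Fin d → ℂ :=
  X (a + k + 1) ω - W *ᵥ X (a + k) ω

/-- The σ-algebra generated by `X_a, …, X_{a+P}`. -/
abbrev windowSigma (X : ℤ → Ω → Fin d → ℂ) (a : ℤ) (P : ℕ) : MeasurableSpace Ω :=
  MeasurableSpace.comap (fun ω (k : Fin (P + 1)) => X (a + (k : ℕ)) ω) inferInstance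

/-- The deviation of `X_{a+k}` from its prediction `W ^ k X_a`. -/
def deviation (W : Matrix (Fin d) (Fin d) ℂ) (X : ℤ → Ω → Fin d → ℂ) (a : ℤ) (k : ℕ) (ω : Ω) :
    Fin d → ℂ :=
  X (a + k) ω - W ^ k *ᵥ X a ω

theorem measurable_mulVec (B : Matrix (Fin d) (Fin d) ℂ) :
    Measurable fun x : Fin d → ℂ => B *ᵥ x :=
  Continuous.measurable (by fun_prop)

theorem measurable_windowSigma (X : ℤ → Ω → Fin d → ℂ) (a : ℤ) {k P : ℕ} (h : k ≤ P) :
    Measurable[windowSigma X a P] (X (a + k)) :=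
  (measurable_pi_apply (⟨k, Nat.lt_succ_of_le h⟩ : Fin (P + 1))).comp
    (comap_measurable fun ω (k : Fin (P + 1)) => X (a + (k : ℕ)) ω)

theorem sigmaOf_le_windowSigma (X : ℤ → Ω → Fin d → ℂ) (a : ℤ) (P : ℕ) :
    sigmaOf (X a) ≤ windowSigma X a P := by
  have h := measurable_windowSigma X a (Nat.zero_le P)
  simp only [Nat.cast_zero, add_zero] at h
  exact h.comap_le

theorem measurable_deviation (W : Matrix (Fin d) (Fin d) ℂ) (X : ℤ → Ω → Fin d → ℂ) (a : ℤ)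
    {k P : ℕ} (h : k ≤ P) : Measurable[windowSigma X a P] (deviation W X a k) := by
  have h1 := measurable_windowSigma X a (Nat.zero_le P)
  simp only [Nat.cast_zero, add_zero] at h1
  exact (measurable_windowSigma X a h).sub ((measurable_mulVec _).comp h1)

theorem deviation_succ (W : Matrix (Fin d) (Fin d) ℂ) (X : ℤ → Ω → Fin d → ℂ) (a : ℤ) (k : ℕ)
    (ω : Ω) : deviation W X a (k + 1) ω = W *ᵥ deviation W X a k ω + innovation W X a k ω := by
  have : a + ((k + 1 : ℕ) : ℤ) = a + k + 1 := by push_cast; ring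
  rw [deviation, deviation, innovation, this, Matrix.mulVec_sub, Matrix.mulVec_mulVec, ← pow_succ']
  abel

end Windows

section Prediction

variable {Ω : Type*} {m : MeasurableSpace Ω} [MeasurableSpace Ω] {μ : Measure Ω}

theorem memLp_mulVec {f : Ω → Fin d → ℂ} (hf : MemLp f 2 μ) (B : Matrix (Fin d) (Fin d) ℂ) :
    MemLp (fun ω => B *ᵥ f ω) 2 μ :=
  (B.mulVecLin.restrictScalars ℝ).toContinuousLinearMap.comp_memLp' hf

theorem integrable_mul_star {f g : Ω → ℂ} (hf : MemLp f 2 μ) (hg : MemLp g 2 μ) :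
    Integrable (fun ω => f ω * star (g ω)) μ :=
  hf.integrable_mul hg.star

variable {α βL βR : ℝ} {BL : Matrix (Fin d) (Fin d) ℂ} {X : ℤ → Ω → Fin d → ℂ}

theorem HasChainDensity.measurable_innovation
    {BR : Matrix (Fin d) (Fin d) ℂ} (h : HasChainDensity μ α A βL BL βR BR X)
    (W : Matrix (Fin d) (Fin d) ℂ) (a : ℤ) (k : ℕ) : Measurable (innovation W X a k) :=
  (h.measurable _).sub ((measurable_mulVec _).comp (h.measurable _))

theorem HasChainDensity.windowSigma_le
    {BR : Matrix (Fin d) (Fin d) ℂ} (h : HasChainDensity μ α A βL BL βR BR X)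
    (a : ℤ) (k : ℕ) : windowSigma X a k ≤ ‹MeasurableSpace Ω› :=
  (measurable_pi_lambda (fun ω (i : Fin (k + 1)) => X (a + (i : ℕ)) ω)
    fun _ => h.measurable _).comap_le

variable [IsProbabilityMeasure μ]

theorem HasChainDensity.innovation_moments (hA : A.PosDef) (hW : IsStableSolvent A W)
    (h : HasChainDensity μ α A βL BL βR (rightBoundary A W) X) (a : ℤ) (k : ℕ) :
    MemLp (innovation W X a k) 2 μ ∧ ∫ ω, innovation W X a k ω ∂μ = 0 ∧
      ∀ i j, ∫ ω, innovation W X a k ω i * star (innovation W X a k ω j) ∂μ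
        = 2 * (innovationPrecision A W)⁻¹ i j := by
  obtain ⟨-, -, c, hc⟩ := h.indepFun_innovation hA hW a k
  exact moments_of_map_eq_smul_gaussMeasure (posDef_innovationPrecision hA hW)
    ((h.measurable _).sub ((measurable_mulVec _).comp (h.measurable _))) hc

/-- A function of an innovation is conditionally constant given the past. -/
theorem HasChainDensity.condExp_comp_innovation (hA : A.PosDef) (hW : IsStableSolvent A W)
    (h : HasChainDensity μ α A βL BL βR (rightBoundary A W) X) (a : ℤ) (k : ℕ)
    (hm : m ≤ windowSigma X a k) {E : Type*} [NormedAddCommGroup E]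
    [NormedSpace ℝ E] [CompleteSpace E] {f : (Fin d → ℂ) → E} (hf : Continuous f) :
    μ[fun ω => f (innovation W X a k ω)|m] =ᵐ[μ] fun _ => ∫ ω, f (innovation W X a k ω) ∂μ := by
  have hind : Indep (MeasurableSpace.comap (innovation W X a k) inferInstance) m μ :=
    indep_of_indep_of_le_right ((h.indepFun_innovation hA hW a k).1).symm hm
  exact condExp_indep_eq (h.measurable_innovation W a k).comap_le
    (hm.trans (h.windowSigma_le a k))
    (hf.stronglyMeasurable.comp_measurable (comap_measurable (innovation W X a k))) hind

/-- Induction on $X_{a+k+1}=WX_{a+k}+Y_k$, where the innovation $Y_k$ is centered and independent of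
the window containing $X_a$. -/
theorem HasChainDensity.condExp_add_natCast (hA : A.PosDef) (hW : IsStableSolvent A W)
    (hG : (BL + rightBoundary A W).PosDef)
    (h : HasChainDensity μ α A βL BL βR (rightBoundary A W) X) (a : ℤ) (k : ℕ) :
    μ[X (a + k)|sigmaOf (X a)] =ᵐ[μ] fun ω => W ^ k *ᵥ X a ω := by
  induction k with
  | zero =>
    have h0 : a + ((0 : ℕ) : ℤ) = a := by simp
    rw [h0, condExp_of_stronglyMeasurable (h.measurable a).comap_le
      (comap_measurable (X a)).stronglyMeasurable ((h.memLp hA hW hG a).integrable one_le_two)]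
    simp only [pow_zero, Matrix.one_mulVec]
    exact EventuallyEq.rfl
  | succ k ih =>
    have hsum : X (a + (k + 1 : ℕ)) = (fun ω => W *ᵥ X (a + k) ω) + innovation W X a k := by
      have : a + ((k + 1 : ℕ) : ℤ) = a + k + 1 := by push_cast; ring
      ext1 ω
      rw [Pi.add_apply, innovation, this]
      abel
    have hX := (h.memLp hA hW hG (a + k))
    obtain ⟨hY, hY0, -⟩ := h.innovation_moments hA hW a k
    have h1 := condExp_add ((memLp_mulVec hX W).integrable one_le_two)
      (hY.integrable one_le_two) (sigmaOf (X a))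
    have h2 := (W.mulVecLin.restrictScalars ℝ).toContinuousLinearMap.comp_condExp_comm
      (m := sigmaOf (X a)) (hX.integrable one_le_two)
    have h3 := h.condExp_comp_innovation hA hW a k (sigmaOf_le_windowSigma X a k)
      (f := fun y => y) continuous_id
    rw [hsum]
    filter_upwards [h1, h2, h3, ih] with ω e1 e2 e3 e4
    rw [e1, Pi.add_apply]
    have e3' : (μ[innovation W X a k|sigmaOf (X a)]) ω = 0 := by
      rw [← hY0]; exact e3
    have e2' : (μ[fun ω => W *ᵥ X (a + k) ω|sigmaOf (X a)]) ω
        = W *ᵥ (μ[X (a + k)|sigmaOf (X a)]) ω := e2.symm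
    rw [e3', e2', e4, add_zero, Matrix.mulVec_mulVec, ← pow_succ']

theorem HasChainDensity.memLp_deviation (hA : A.PosDef) (hW : IsStableSolvent A W)
    (hG : (BL + rightBoundary A W).PosDef)
    (h : HasChainDensity μ α A βL BL βR (rightBoundary A W) X) (a : ℤ) (k : ℕ) :
    MemLp (deviation W X a k) 2 μ :=
  (h.memLp hA hW hG _).sub (memLp_mulVec (h.memLp hA hW hG _) _)

/-- An innovation is conditionally uncorrelated with the past. -/
theorem HasChainDensity.hasConstCondExp_mul_innovation (hA : A.PosDef)
    (hW : IsStableSolvent A W)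
    (h : HasChainDensity μ α A βL BL βR (rightBoundary A W) X) (a : ℤ) (k : ℕ) {H : Ω → ℂ}
    (hH : Measurable[windowSigma X a k] H) (hH2 : MemLp H 2 μ) (j : Fin d) :
    HasConstCondExp (sigmaOf (X a)) μ (fun ω => H ω * star (innovation W X a k ω j)) 0 := by
  obtain ⟨hY, hY0, -⟩ := h.innovation_moments hA hW a k
  have hYj : MemLp (fun ω => innovation W X a k ω j) 2 μ := memLp_pi_iff.1 hY j
  have hint := integrable_mul_star hH2 hYj
  refine ⟨hint, ?_⟩
  have hle := h.windowSigma_le a k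
  -- Condition first on the whole window, where `H` is known and factors out; the tower property in
  -- `h5` then descends to $X_a$.
  have h1 := condExp_bilin_of_stronglyMeasurable_left (ContinuousLinearMap.mul ℝ ℂ)
    hH.stronglyMeasurable hint (hYj.star.integrable one_le_two)
  have h2 := h.condExp_comp_innovation hA hW a k le_rfl (f := fun y => star (y j))
    (by fun_prop)
  have h3 : ∫ ω, star (innovation W X a k ω j) ∂μ = 0 := by
    have e1 : ∫ ω, innovation W X a k ω j ∂μ = 0 := by
      rw [← eval_integral fun i => (memLp_pi_iff.1 hY i).integrable one_le_two, hY0]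
      rfl
    have e2 := integral_conj (μ := μ) (f := fun ω => innovation W X a k ω j)
    rw [e1, map_zero] at e2
    exact e2
  have h4 : μ[fun ω => H ω * star (innovation W X a k ω j)|windowSigma X a k] =ᵐ[μ] 0 := by
    filter_upwards [h1, h2] with ω e1 e2
    have e1' : (μ[fun ω => H ω * star (innovation W X a k ω j)|windowSigma X a k]) ω
        = H ω * (μ[fun ω => star (innovation W X a k ω j)|windowSigma X a k]) ω := e1
    rw [e1', e2, h3, mul_zero]
    rfl
  have h5 := condExp_condExp_of_le (μ := μ) (f := fun ω => H ω * star (innovation W X a k ω j))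
    (sigmaOf_le_windowSigma X a k) hle
  refine h5.symm.trans ((condExp_congr_ae h4).trans ?_)
  rw [condExp_zero]
  exact EventuallyEq.rfl

theorem HasChainDensity.hasConstCondExp_innovation (hA : A.PosDef) (hW : IsStableSolvent A W)
    (h : HasChainDensity μ α A βL BL βR (rightBoundary A W) X) (a : ℤ) (k : ℕ) (i j : Fin d) :
    HasConstCondExp (sigmaOf (X a)) μ
      (fun ω => innovation W X a k ω i * star (innovation W X a k ω j))
      (2 * (innovationPrecision A W)⁻¹ i j) := by
  obtain ⟨hY, -, hY2⟩ := h.innovation_moments hA hW a k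
  refine ⟨integrable_mul_star (memLp_pi_iff.1 hY i) (memLp_pi_iff.1 hY j), ?_⟩
  rw [← hY2 i j]
  exact h.condExp_comp_innovation hA hW a k (sigmaOf_le_windowSigma X a k)
    (f := fun y => y i * star (y j)) (by fun_prop)

/-- The conditional covariance of two deviations. -/
def deviationCov (A : BlockMatrix d) (W : Matrix (Fin d) (Fin d) ℂ) (k m : ℕ) :
    Matrix (Fin d) (Fin d) ℂ :=
  (∑ i ∈ Finset.range k, W ^ i * (innovationPrecision A W)⁻¹ * Wᴴ ^ i) * Wᴴ ^ m

theorem deviationCov_succ_zero (A : BlockMatrix d) (W : Matrix (Fin d) (Fin d) ℂ) (k : ℕ) :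
    deviationCov A W (k + 1) 0
      = W * deviationCov A W k 0 * Wᴴ + (innovationPrecision A W)⁻¹ := by
  simp only [deviationCov, Finset.sum_range_succ', pow_zero, mul_one, one_mul, Finset.mul_sum,
    Finset.sum_mul]
  congr 1
  exact Finset.sum_congr rfl fun i _ => by rw [pow_succ', pow_succ]; noncomm_ring

theorem deviationCov_succ_right (A : BlockMatrix d) (W : Matrix (Fin d) (Fin d) ℂ) (k m : ℕ) :
    deviationCov A W k (m + 1) = deviationCov A W k m * Wᴴ := by
  rw [deviationCov, deviationCov, pow_succ, ← mul_assoc]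

/-- The deviation obeys $D_{k+1}=WD_k+Y_k$. Of the four products in the expansion the two mixed ones
have conditional mean zero, and the others reproduce the recursion `deviationCov_succ_zero`. -/
theorem HasChainDensity.hasConstCondExp_deviation_self (hA : A.PosDef)
    (hW : IsStableSolvent A W) (hG : (BL + rightBoundary A W).PosDef)
    (h : HasChainDensity μ α A βL BL βR (rightBoundary A W) X) (a : ℤ) (k : ℕ) (i j : Fin d) :
    HasConstCondExp (sigmaOf (X a)) μ
      (fun ω => deviation W X a k ω i * star (deviation W X a k ω j))
      (2 * deviationCov A W k 0 i j) := by
  induction k generalizing i j with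
  | zero =>
    simpa [deviation, deviationCov] using HasConstCondExp.zero (m := sigmaOf (X a)) (μ := μ)
  | succ k ih =>
    have hcross : ∀ b j, HasConstCondExp (sigmaOf (X a)) μ
        (fun ω => deviation W X a k ω b * star (innovation W X a k ω j)) 0 := fun b j =>
      h.hasConstCondExp_mul_innovation hA hW a k
        ((measurable_pi_apply b).comp (measurable_deviation W X a le_rfl))
        (memLp_pi_iff.1 (h.memLp_deviation hA hW hG a k) b) j
    have h1 := HasConstCondExp.sum Finset.univ fun b =>
      HasConstCondExp.sum Finset.univ fun c => (ih b c).const_mul (W i b * star (W j c))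
    have h2 := HasConstCondExp.sum Finset.univ fun b => (hcross b j).const_mul (W i b)
    have h3 := HasConstCondExp.sum Finset.univ fun c => (hcross c i).star.const_mul (star (W j c))
    have h4 := ((h1.add h2).add h3).add (h.hasConstCondExp_innovation hA hW a k i j)
    convert! h4 using 1
    · ext1 ω
      have e1 : ∑ b, ∑ c, W i b * star (W j c)
            * (deviation W X a k ω b * star (deviation W X a k ω c))
          = (W *ᵥ deviation W X a k ω) i * star ((W *ᵥ deviation W X a k ω) j) := by
        simp only [Matrix.mulVec, dotProduct, star_sum, star_mul', Finset.sum_mul_sum]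
        exact Finset.sum_congr rfl fun b _ => Finset.sum_congr rfl fun c _ => by ring
      have e2 : ∑ b, W i b * (deviation W X a k ω b * star (innovation W X a k ω j))
          = (W *ᵥ deviation W X a k ω) i * star (innovation W X a k ω j) := by
        simp only [Matrix.mulVec, dotProduct, Finset.sum_mul, mul_assoc]
      have e3 : ∑ c, star (W j c) * star (deviation W X a k ω c * star (innovation W X a k ω i))
          = innovation W X a k ω i * star ((W *ᵥ deviation W X a k ω) j) := by
        simp only [Matrix.mulVec, dotProduct, star_sum, star_mul', star_star, Finset.mul_sum]
        exact Finset.sum_congr rfl fun b _ => by ring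
      rw [e1, e2, e3, deviation_succ, Pi.add_apply, Pi.add_apply, star_add]
      ring
    · rw [deviationCov_succ_zero, Matrix.add_apply, mul_add]
      simp only [Matrix.mul_apply, Matrix.conjTranspose_apply, Finset.sum_mul, Finset.mul_sum,
        mul_zero, star_zero, Finset.sum_const_zero, add_zero]
      congr 1
      rw [Finset.sum_comm]
      exact Finset.sum_congr rfl fun b _ => Finset.sum_congr rfl fun c _ => by ring

/-- Advancing only the later site adds an innovation uncorrelated with the earlier deviation, so
each step just multiplies by $W^*$ on the right. -/
theorem HasChainDensity.hasConstCondExp_deviation (hA : A.PosDef)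
    (hW : IsStableSolvent A W) (hG : (BL + rightBoundary A W).PosDef)
    (h : HasChainDensity μ α A βL BL βR (rightBoundary A W) X) (a : ℤ) (k m : ℕ) (i j : Fin d) :
    HasConstCondExp (sigmaOf (X a)) μ
      (fun ω => deviation W X a k ω i * star (deviation W X a (k + m) ω j))
      (2 * deviationCov A W k m i j) := by
  induction m generalizing j with
  | zero => exact h.hasConstCondExp_deviation_self hA hW hG a k i j
  | succ m ih =>
    have h1 := HasConstCondExp.sum Finset.univ fun c => (ih c).const_mul (star (W j c))
    have h2 := h.hasConstCondExp_mul_innovation hA hW a (k + m)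
        ((measurable_pi_apply i).comp (measurable_deviation W X a (Nat.le_add_right k m)))
        (memLp_pi_iff.1 (h.memLp_deviation hA hW hG a k) i) j
    convert! h1.add h2 using 1
    · ext1 ω
      rw [← add_assoc, deviation_succ]
      simp only [Pi.add_apply, Matrix.mulVec, dotProduct, star_add, star_sum, star_mul',
        mul_add, Finset.mul_sum]
      congr 1
      exact Finset.sum_congr rfl fun b _ => by ring
    · rw [deviationCov_succ_right]
      simp only [Matrix.mul_apply, Matrix.conjTranspose_apply, Finset.mul_sum, add_zero]
      exact Finset.sum_congr rfl fun b _ => by ring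

theorem HasChainDensity.condCov_eq (hA : A.PosDef)
    (hW : IsStableSolvent A W) (hG : (BL + rightBoundary A W).PosDef)
    (h : HasChainDensity μ α A βL BL βR (rightBoundary A W) X) (a : ℤ) (k m : ℕ) :
    ∀ᵐ ω ∂μ, condCov (sigmaOf (X a)) μ (X (a + k)) (X (a + (k + m : ℕ))) ω
      = deviationCov A W k m := by
  have hk := h.condExp_add_natCast hA hW hG a k
  have hkm := h.condExp_add_natCast hA hW hG a (k + m)
  have hentry : ∀ i j, ∀ᵐ ω ∂μ,
      condCov (sigmaOf (X a)) μ (X (a + k)) (X (a + (k + m : ℕ))) ω i j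
        = deviationCov A W k m i j := by
    intro i j
    have h1 := (h.hasConstCondExp_deviation hA hW hG a k m i j).const_mul (1 / 2)
    have h2 : (fun ω' => (1 / 2 : ℂ) * ((X (a + k) ω' i - (μ[X (a + k)|sigmaOf (X a)]) ω' i)
          * star (X (a + (k + m : ℕ)) ω' j
            - (μ[X (a + (k + m : ℕ))|sigmaOf (X a)]) ω' j)))
        =ᵐ[μ] fun ω => (1 / 2 : ℂ)
          * (deviation W X a k ω i * star (deviation W X a (k + m) ω j)) := by
      filter_upwards [hk, hkm] with ω e1 e2
      rw [e1, e2]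
      rfl
    filter_upwards [(condExp_congr_ae (m := sigmaOf (X a)) h2).trans h1.2] with ω e
    rw [condCov, Matrix.of_apply, e]
    ring
  filter_upwards [ae_all_iff.2 fun i => ae_all_iff.2 fun j => hentry i j] with ω hω
  ext i j
  exact hω i j

end Prediction

end GaussMarkov
end

/-! ### Normalized Fourier coefficients and assembly of the theorem. -/

noncomputable section

open Filter Topology Matrix ProbabilityTheory

namespace GaussMarkov

variable {d : ℕ} {A : BlockMatrix d} {V W : Matrix (Fin d) (Fin d) ℂ}

theorem fourierC_zero_inv (hA : A.PosDef) (hV : IsStableSolvent (swapBlocks A) V)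
    (hW : IsStableSolvent A W) : (fourierC A 0)⁻¹ = sitePrecision A V W := by
  have h := fourierC_natCast hA hV hW 0
  rw [Nat.cast_zero, pow_zero, one_mul] at h
  rw [h, Matrix.nonsing_inv_nonsing_inv _ (isUnit_det_of_posDef (posDef_sitePrecision hA hV hW))]

theorem fourierC_natCast_mul (hA : A.PosDef) (hV : IsStableSolvent (swapBlocks A) V)
    (hW : IsStableSolvent A W) (k : ℕ) : fourierC A k * (fourierC A 0)⁻¹ = V ^ k := by
  rw [fourierC_zero_inv hA hV hW, fourierC_natCast hA hV hW, Matrix.nonsing_inv_mul_cancel_right _ _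
    (isUnit_det_of_posDef (posDef_sitePrecision hA hV hW))]

theorem fourierC_neg_natCast_mul (hA : A.PosDef) (hV : IsStableSolvent (swapBlocks A) V)
    (hW : IsStableSolvent A W) (k : ℕ) :
    fourierC A (-(k : ℤ)) * (fourierC A 0)⁻¹ = W ^ k := by
  rw [fourierC_zero_inv hA hV hW, fourierC_neg_natCast hA hV hW,
    Matrix.nonsing_inv_mul_cancel_right _ _
      (isUnit_det_of_posDef (posDef_sitePrecision hA hV hW))]

theorem zpow_neg_natCast_eq_inv_pow (B : Matrix (Fin d) (Fin d) ℂ) (k : ℕ) :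
    B ^ (-(k : ℤ)) = B⁻¹ ^ k := by
  rw [Matrix.zpow_neg_natCast, Matrix.inv_pow']

end GaussMarkov

end

open GaussMarkov in
theorem theorem5p2 {d : ℕ} (hd : 0 < d) (A : BlockMatrix d) (hA : A.PosDef)
    (hfull : FullRank A) (hsimple : SimpleZeros A)
    (u : ℂ → Fin d → ℂ) (hu : SpansKernels A u) :
    ∃ (bIn : Module.Basis (zerosIn A) ℂ (Fin d → ℂ))
      (bOut : Module.Basis (zerosOut A) ℂ (Fin d → ℂ)),
      (∀ w : zerosIn A, bIn w = u w) ∧ (∀ w : zerosOut A, bOut w = u w) ∧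
      IsLeftSchurInvariant A (leftBoundary A (diagIn bOut)) ∧
      IsRightSchurInvariant A (rightBoundary A (diagIn bIn)) ∧
      ∀ {Ω : Type*} [MeasurableSpace Ω] (μ : Measure Ω) [IsProbabilityMeasure μ]
        (α βL βR : ℝ) (_ : 0 < α) (_ : 0 < βL) (_ : 0 < βR) (X : ℤ → Ω → Fin d → ℂ)
        (_ : IsGibbsProcess μ α A βL (leftBoundary A (diagIn bOut))
          βR (rightBoundary A (diagIn bIn)) X),
        (∀ l : ℤ, MemLp (X l) 2 μ) ∧
        (∀ (l : ℤ) (k : ℕ), ∀ᵐ ω ∂μ,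
          (μ[X (l - k)|sigmaOf (X l)]) ω
              = Matrix.mulVec (fourierC A k * (fourierC A 0)⁻¹) (X l ω) ∧
          Matrix.mulVec (fourierC A k * (fourierC A 0)⁻¹) (X l ω)
              = Matrix.mulVec (diagIn bOut ^ (-(k : ℤ))) (X l ω) ∧
          Matrix.mulVec (diagIn bOut ^ (-(k : ℤ))) (X l ω)
              = ∑ᶠ w : zerosOut A, ((w : ℂ) ^ (-(k : ℤ)) * bOut.repr (X l ω) w) • u w) ∧
        (∀ (l : ℤ) (k : ℕ), ∀ᵐ ω ∂μ,
          (μ[X (l + k)|sigmaOf (X l)]) ω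
              = Matrix.mulVec (fourierC A (-(k : ℤ)) * (fourierC A 0)⁻¹) (X l ω) ∧
          Matrix.mulVec (fourierC A (-(k : ℤ)) * (fourierC A 0)⁻¹) (X l ω)
              = Matrix.mulVec (diagIn bIn ^ k) (X l ω) ∧
          Matrix.mulVec (diagIn bIn ^ k) (X l ω)
              = ∑ᶠ w : zerosIn A, ((w : ℂ) ^ k * bIn.repr (X l ω) w) • u w) ∧
        (∀ (l : ℤ) (k₁ k₂ : ℕ), k₁ ≤ k₂ → ∀ᵐ ω ∂μ,
          condCov (sigmaOf (X l)) μ (X (l + k₁)) (X (l + k₂)) ω * (fourierC A 0)⁻¹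
            = diagIn bOut ^ ((k₁ : ℤ) - k₂) - diagIn bIn ^ k₁ * diagIn bOut ^ (-(k₂ : ℤ))) := by

  obtain ⟨⟨bIn, hIn⟩, bOut, hOut⟩ := exists_bases hA hfull hsimple hu
  have hW := isStableSolvent_diagIn hfull hA hu bIn hIn
  have hV := isStableSolvent_inv_diagIn hfull hA hu bOut hOut
  have hA' := posDef_swapBlocks hA
  have hfin := finite_zeros hA (isUnit_det_blkLR hfull)
  have finIn : (zerosIn A).Finite := hfin.subset fun w h => h.1
  have finOut : (zerosOut A).Finite := hfin.subset fun w h => h.1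
  -- The left boundary is definitionally the right boundary of the swapped matrix for its own stable
  -- solvent, so all forward results apply to the reversed process.
  have hleft : leftBoundary A (diagIn bOut) = rightBoundary (swapBlocks A) (diagIn bOut)⁻¹ := rfl
  have hG := posDef_sitePrecision hA hV hW
  refine ⟨bIn, bOut, hIn, hOut, ?_, isRightSchurInvariant_rightBoundary hA hW, ?_⟩
  · rw [hleft]
    exact isLeftSchurInvariant_of_swapBlocks (isRightSchurInvariant_rightBoundary hA' hV)
  intro Ω _ μ _ α βL βR _ _ _ X hX
  have hF := hX.hasChainDensity
  have hR := hF.reverse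
  rw [hleft] at hF hR
  have hG' : (rightBoundary A (diagIn bIn)
      + rightBoundary (swapBlocks A) (diagIn bOut)⁻¹).PosDef := by
    rw [add_comm]
    exact hG
  refine ⟨fun l => hF.memLp hA hW hG l, fun l k => ?_, fun l k => ?_, fun l k₁ k₂ hk => ?_⟩
  -- In reversed time the site $l$ is $-l$, and $k$ steps forward lead to $X_{l-k}$.
  · have h := hR.condExp_add_natCast hA' hV hG' (-l) k
    have e : -(-l + (k : ℤ)) = l - k := by ring
    simp only [neg_neg, e] at h
    filter_upwards [h] with ω hω
    rw [fourierC_natCast_mul hA hV hW, zpow_neg_natCast_eq_inv_pow]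
    refine ⟨hω, rfl, ?_⟩
    rw [mulVec_eq_finsum finOut bOut (f := fun w => w ^ (-(k : ℤ))) fun w => ?_]
    · simp only [hOut]
    · rw [pow_mulVec_eigenvector (inv_diagIn_mulVec (fun w h => h.1.1) bOut w)]
      simp
  · filter_upwards [hF.condExp_add_natCast hA hW hG l k] with ω hω
    rw [fourierC_neg_natCast_mul hA hV hW]
    refine ⟨hω, rfl, ?_⟩
    rw [mulVec_eq_finsum finIn bIn (f := fun w => w ^ k) fun w =>
      pow_mulVec_eigenvector (diagIn_mulVec bIn w) k]
    simp only [hIn]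
  · obtain ⟨m, rfl⟩ := Nat.exists_eq_add_of_le hk
    -- With $k_2=k_1+m$ the telescoped sum is $V^m-W^{k_1}V^{k_1+m}$, and powers of `V` are negative
    -- powers of $W_{>1}$.
    filter_upwards [hF.condCov_eq hA hW hG l k₁ m] with ω hω
    have e : (k₁ : ℤ) - ((k₁ + m : ℕ) : ℤ) = -(m : ℤ) := by push_cast; ring
    rw [hω, fourierC_zero_inv hA hV hW, deviationCov,
      sum_pow_mul_inv_innovationPrecision hA hV hW, e, zpow_neg_natCast_eq_inv_pow,
      zpow_neg_natCast_eq_inv_pow]
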